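/- Conventions. Vocabularies are countable, structures are non-empty, and sentences are sentences of $L_{\omega_1,\omega}$. A sentence of $L_{\omega_1,\omega}(\tau)$ is complete if it has a model and decides every sentence of $L_{\omega_1,\omega}(\tau)$; it then has exactly one countable model up to isomorphism. A unary predicate $P$ defines a set of absolute indiscernibles in a countable structure $M$ if $P^M$ is infinite and every permutation of $P^M$ extends to an automorphism of $M$. A sentence characterizes a cardinal $\mu$ if it has a model of size $\mu$ and no larger model. A model is maximal if it has no proper $L_{\omega_1,\omega}$-elementary extension. For an infinite cardinal $\kappa$, a complete sentence $\theta$ whose vocabulary contains a unary predicate $P$ homogeneously characterizes $\kappa$ if $\theta$ has no model of size $\kappa^+$, $P$ defines a set of absolute indiscernibles in the countable model of $\theta$, and $\theta$ has a maximal model $M$ with $|M|=|P^M|=\kappa$. Theorem. (A) There is a complete $L_{\omega_1,\omega}$-sentence $\varphi$ in a vocabulary with unary predicates $X,Y,U$ and a binary predicate $<$ such that in every model of $\varphi$ the sets $X,Y,U$ are pairwise disjoint, $Y$ is non-empty and is densely linearly ordered by $<$ without endpoints, every element of $Y$ has at most $|X|$ predecessors in $Y$, and: 1. $\varphi$ has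 arbitrarily large models; 2. if $M\models\varphi$, then $|M|\le |X^M|^+$; 3. for each infinite cardinal $\kappa$ there is a model $M$ of $\varphi$ with $|M|=\kappa^+$ and $|X^M|=\kappa$; 4. in the countable model of $\varphi$, $U$ defines a set of absolute indiscernibles; 5. if $M\models\varphi$, then $|U^M|\le|X^M|$; 6. for each infinite cardinal $\kappa$ there is a model $N$ of $\varphi$ with $|N|=\kappa^+$ and $|U^N|=\kappa$. (B) If an infinite cardinal $\kappa$ is homogeneously characterized by a complete $L_{\omega_1,\omega}(\tau)$-sentence, then there is a complete $L_{\omega_1,\omega}$-sentence $\chi$ in a vocabulary $\tau'$ extending $\tau$ with a unary predicate $U$ such that: 1. $\chi$ characterizes $\kappa^+$; 2. $U$ defines a set of absolute indiscernibles in the countable model of $\chi$; 3. $|U^M|\le\kappa$ for every model $M$ of $\chi$, and $|U^M|=\kappa$ for some model $M$ of $\chi$. -/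

import Mathlib

open FirstOrder Cardinal

universe u

/-- Formulas of `L_{ω₁,ω}` over a first-order vocabulary `L`, with free variables among
`x_0, …, x_{n-1}`: atomic formulas, implication and falsity, conjunctions of countably many
formulas (all with the same finite stock of free variables), and one quantifier at a time. -/
inductive InfFormula (L : FirstOrder.Language.{0, 0}) : ℕ → Type
  | falsum {n : ℕ} : InfFormula L n
  | equal {n : ℕ} (t₁ t₂ : L.Term (Fin n)) : InfFormula L n
  | rel {n k : ℕ} (R : L.Relations k) (ts : Fin k → L.Term (Fin n)) : InfFormula L n
  | imp {n : ℕ} (φ ψ : InfFormula L n) : InfFormula L n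
  | conj {n : ℕ} (φ : ℕ → InfFormula L n) : InfFormula L n
  | all {n : ℕ} (φ : InfFormula L (n + 1)) : InfFormula L n

namespace InfFormula

variable {L : FirstOrder.Language.{0, 0}}

/-- Negation. -/
def not {n : ℕ} (φ : InfFormula L n) : InfFormula L n := φ.imp falsum

/-- Satisfaction of a formula in a structure `M` under an assignment of its free variables. -/
def Realize (M : Type u) [L.Structure M] : {n : ℕ} → InfFormula L n → (Fin n → M) → Prop
  | _, falsum, _ => False
  | _, equal t₁ t₂, v => t₁.realize v = t₂.realize v
  | _, rel R ts, v => FirstOrder.Language.Structure.RelMap R fun i => (ts i).realize v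
  | _, imp φ ψ, v => Realize M φ v → Realize M ψ v
  | _, conj φ, v => ∀ i, Realize M (φ i) v
  | _, all φ, v => ∀ a : M, Realize M φ (Fin.snoc v a)

end InfFormula

/-- Sentences of `L_{ω₁,ω}`. -/
abbrev InfSentence (L : FirstOrder.Language.{0, 0}) : Type := InfFormula L 0

section Notions

variable {L : FirstOrder.Language.{0, 0}}

/-- `M` is a model of `φ`. As usual in model theory, models are non-empty. -/
def IsModel (M : Type u) [L.Structure M] (φ : InfSentence L) : Prop :=
  Nonempty M ∧ φ.Realize M Fin.elim0

/-- The interpretation in `M` of a unary predicate. -/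
def predSet (M : Type u) [L.Structure M] (P : L.Relations 1) : Set M :=
  {a | FirstOrder.Language.Structure.RelMap P ![a]}

/-- `φ` is a complete sentence: it has a model, and it decides every sentence of `L_{ω₁,ω}`
in the same vocabulary. -/
def IsCompleteSentence (φ : InfSentence L) : Prop :=
  (∃ (M : Type u) (_ : L.Structure M), IsModel M φ) ∧
  ∀ ψ : InfSentence L,
    (∀ (M : Type u) [L.Structure M], IsModel M φ → IsModel M ψ) ∨
    (∀ (M : Type u) [L.Structure M], IsModel M φ → IsModel M ψ.not)

/-- `P` is a set of absolute indiscernibles for `M`: it is infinite in `M`, and each of its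
permutations extends to an automorphism of `M`. (Used for countable `M`.) -/
def IsAbsIndiscernible (M : Type u) [L.Structure M] (P : L.Relations 1) : Prop :=
  (predSet M P).Infinite ∧
  ∀ σ : Equiv.Perm (predSet M P), ∃ f : M ≃[L] M, ∀ a : predSet M P, f (a : M) = (σ a : M)

/-- The embedding `f` is `L_{ω₁,ω}`-elementary. -/
def IsInfElementary {M N : Type u} [L.Structure M] [L.Structure N] (f : M ↪[L] N) : Prop :=
  ∀ (n : ℕ) (ψ : InfFormula L n) (v : Fin n → M), ψ.Realize M v ↔ ψ.Realize N (f ∘ v)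

/-- `M` is a maximal model of `φ`: a model without proper elementary extension. -/
def IsMaximalModel (M : Type u) [L.Structure M] (φ : InfSentence L) : Prop :=
  IsModel M φ ∧
  ∀ (N : Type u) [L.Structure N] (f : M ↪[L] N),
    IsModel N φ → IsInfElementary f → Function.Surjective f

/-- `φ`, together with the unary predicate `P`, homogeneously characterizes the infinite
cardinal `κ`. -/
structure HomogeneouslyCharacterizes (φ : InfSentence L) (P : L.Relations 1)
    (κ : Cardinal.{u}) : Prop where
  infinite : ℵ₀ ≤ κ
  complete : IsCompleteSentence.{u} φ
  no_model_succ : ∀ (M : Type u) [L.Structure M], IsModel M φ → #M ≠ Order.succ κ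
  indiscernible : ∀ (M : Type u) [L.Structure M], Countable M → IsModel M φ →
    IsAbsIndiscernible M P
  maximal_model : ∃ (M : Type u) (_ : L.Structure M),
    IsMaximalModel M φ ∧ #M = κ ∧ #(predSet M P) = κ

/-- `φ` characterizes `κ`: it has a model of size `κ` and no larger model. -/
def Characterizes (φ : InfSentence L) (κ : Cardinal.{u}) : Prop :=
  (∃ (M : Type u) (_ : L.Structure M), IsModel M φ ∧ #M = κ) ∧
  ∀ (M : Type u) [L.Structure M], IsModel M φ → #M ≤ κ

/-- The interpretation in `M` of a binary predicate. -/
def binRel (M : Type u) [L.Structure M] (R : L.Relations 2) (a b : M) : Prop :=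
  FirstOrder.Language.Structure.RelMap R ![a, b]

/-- The sorts of `M`: `X`, `Y`, `U` are pairwise disjoint, `Y` is non-empty and is linearly
ordered by `lt`, densely and without endpoints, and every element of `Y` has at most `|X|`
predecessors in `Y`. -/
structure HasOrderedSort (M : Type u) [L.Structure M] (X Y U : L.Relations 1)
    (lt : L.Relations 2) : Prop where
  disjoint_X_Y : Disjoint (predSet M X) (predSet M Y)
  disjoint_X_U : Disjoint (predSet M X) (predSet M U)
  disjoint_Y_U : Disjoint (predSet M Y) (predSet M U)
  nonempty : (predSet M Y).Nonempty
  irrefl : ∀ a ∈ predSet M Y, ¬ binRel M lt a a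
  trans : ∀ a ∈ predSet M Y, ∀ b ∈ predSet M Y, ∀ c ∈ predSet M Y,
    binRel M lt a b → binRel M lt b c → binRel M lt a c
  total : ∀ a ∈ predSet M Y, ∀ b ∈ predSet M Y, binRel M lt a b ∨ a = b ∨ binRel M lt b a
  dense : ∀ a ∈ predSet M Y, ∀ b ∈ predSet M Y, binRel M lt a b →
    ∃ c ∈ predSet M Y, binRel M lt a c ∧ binRel M lt c b
  no_min : ∀ a ∈ predSet M Y, ∃ b ∈ predSet M Y, binRel M lt b a
  no_max : ∀ a ∈ predSet M Y, ∃ b ∈ predSet M Y, binRel M lt a b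
  segment_le : ∀ a ∈ predSet M Y, #{b : M // b ∈ predSet M Y ∧ binRel M lt b a} ≤ #(predSet M X)

end Notions

/-! Both parts come from one construction. Over a model of a complete sentence `θ` whose predicate
`P` is absolutely indiscernible, with X the set defined by `P`, two sorts are added: a linear order
Y and a set U. They are tied to X by a projection from X onto U and, for each x in X, a partial
function F(·, x) on Y with values below its arguments. The axioms `IsTower` say that this "tower" is
generic for finite configurations and locally finite: a point of Y has a finite closure under
finitely many of the functions.

Cardinal bounds. By genericity every z < y is F(y, x) for some x, so y has at most |X| predecessors
and |Y| ≤ |X|⁺ (`mk_Y_le`). The projection gives |U| ≤ |X| (`mk_U_le`).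

Categoricity. Local finiteness lets a finite partial isomorphism have a domain in Y closed under the
functions in play, and genericity then extends it. So countable towers are isomorphic over any
prescribed bijection of the sorts U (`IsTower.exists_equiv`). The resulting bijection of the sorts X
is uncontrolled, but it lifts to the models of `θ` because `P` is absolutely indiscernible. Hence
the sentence for the whole structure has one countable model, in which U is absolutely
indiscernible, and downward Löwenheim–Skolem makes it complete.

Large models. A tower with |X| = |U| = κ and |Y| = κ⁺ is built outright (`exists_tower`). Y consists
of κ⁺ well-ordered blocks, each a copy of the non-empty words over a reversed copy of κ. The last
letter of a word prescribes F at that point for finitely many x. Conversely, one x has to meet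
arbitrary finite demands in finitely many of κ⁺ blocks, although there are only κ elements x; this
is possible because κ⁺ ≤ 2^κ and there are 2^κ independent functions on κ
(`exists_independent_functions`). Local finiteness follows by induction on the block and, within it,
on word length (`TowerCode.exists_closed`).

For (A), `θ` is the theory of an infinite set with `P` everything, so X can have any infinite size.
For (B), `θ` is the given sentence, which bounds X by κ. -/

/-! ### Satisfaction is invariant under isomorphism. -/

open FirstOrder.Language in
theorem InfFormula.realize_equiv {L : FirstOrder.Language.{0, 0}} {M N : Type u} [L.Structure M]
    [L.Structure N] (e : M ≃[L] N) {n : ℕ} (φ : InfFormula L n) :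
    ∀ v : Fin n → M, φ.Realize M v ↔ φ.Realize N (e ∘ v) := by
  induction φ with
  | falsum => intro v; rfl
  | equal t₁ t₂ =>
    intro v
    simp [InfFormula.Realize]
  | rel R ts =>
    intro v
    simp only [InfFormula.Realize, HomClass.realize_term]
    exact (StrongHomClass.map_rel e R _).symm
  | imp φ ψ h₁ h₂ => intro v; simp only [InfFormula.Realize, h₁ v, h₂ v]
  | conj φ h => intro v; simp only [InfFormula.Realize, fun i => h i v]
  | all φ h =>
    intro v
    simp only [InfFormula.Realize, h, Fin.comp_snoc]
    exact e.toEquiv.forall_congr_left.trans (by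
      refine forall_congr' fun b => ?_
      have : e (e.toEquiv.symm b) = b := e.toEquiv.apply_symm_apply b
      rw [this])

open FirstOrder.Language in
theorem isModel_equiv {L : FirstOrder.Language.{0, 0}} {M N : Type u} [L.Structure M]
    [L.Structure N] (e : M ≃[L] N) {φ : InfSentence L} (h : IsModel M φ) : IsModel N φ := by
  refine ⟨h.1.map e, ?_⟩
  have := (φ.realize_equiv e Fin.elim0).1 h.2
  rwa [Subsingleton.elim (e ∘ Fin.elim0) Fin.elim0] at this

/-! ### Skolem functions and the downward Löwenheim–Skolem theorem. -/

namespace InfFormula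

variable {L : FirstOrder.Language.{0, 0}}

/-- The matrices of the quantified subformulas of a formula. -/
def matrices : {n : ℕ} → InfFormula L n → Set (Σ n, InfFormula L n)
  | _, falsum => ∅
  | _, equal _ _ => ∅
  | _, rel _ _ => ∅
  | _, imp φ ψ => matrices φ ∪ matrices ψ
  | _, conj φ => ⋃ i, matrices (φ i)
  | n, all φ => insert ⟨n + 1, φ⟩ (matrices φ)

theorem countable_matrices {n : ℕ} (φ : InfFormula L n) : φ.matrices.Countable := by
  induction φ with
  | falsum => exact Set.countable_empty
  | equal => exact Set.countable_empty
  | rel => exact Set.countable_empty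
  | imp φ ψ h₁ h₂ => exact h₁.union h₂
  | conj φ h => exact Set.countable_iUnion h
  | all φ h => exact h.insert _

/-- The language with a Skolem function for each formula in `T`. -/
def skolemLanguage (T : Set (Σ n, InfFormula L n)) : FirstOrder.Language.{0, 0} :=
  ⟨fun n => {ψ : InfFormula L (n + 1) // (⟨n + 1, ψ⟩ : Σ n, InfFormula L n) ∈ T}, fun _ => Empty⟩

open Classical in
/-- Skolem functions choose counterexamples to universally quantified formulas. -/
noncomputable abbrev skolemStructure (T : Set (Σ n, InfFormula L n)) (M : Type u) [L.Structure M]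
    [Nonempty M] : (skolemLanguage T).Structure M where
  funMap f v := Classical.epsilon fun a => ¬ f.1.Realize M (Fin.snoc v a)
  RelMap R := R.elim

/-- A Tarski–Vaught test for one formula: only its own quantified subformulas need witnesses. There
are countably many of these, so countably many Skolem functions are enough even though the logic has
uncountably many formulas. -/
theorem realize_substructure_iff {M : Type u} [L.Structure M] (N : L.Substructure M)
    (T : Set (Σ n, InfFormula L n))
    (hN : ∀ (n : ℕ) (ψ : InfFormula L (n + 1)), (⟨n + 1, ψ⟩ : Σ n, InfFormula L n) ∈ T →
      ∀ v : Fin n → N, (∃ a : M, ¬ ψ.Realize M (Fin.snoc (fun i => (v i : M)) a)) →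
        ∃ a : N, ¬ ψ.Realize M (Fin.snoc (fun i => (v i : M)) (a : M)))
    {n : ℕ} (φ : InfFormula L n) (hφ : φ.matrices ⊆ T) (v : Fin n → N) :
    φ.Realize N v ↔ φ.Realize M (fun i => (v i : M)) := by
  have hterm : ∀ {n : ℕ} (t : L.Term (Fin n)) (v : Fin n → N),
      t.realize (fun i => (v i : M)) = ((t.realize v : N) : M) := fun t v =>
    FirstOrder.Language.HomClass.realize_term N.subtype (t := t) (v := v)
  induction φ with
  | falsum => rfl
  | equal t₁ t₂ => simp only [Realize, hterm, Subtype.coe_inj]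
  | rel R ts =>
    simp only [Realize, hterm]
    exact (N.subtype.map_rel R _).symm
  | imp φ ψ h₁ h₂ =>
    simp only [Realize, h₁ (Set.union_subset_iff.1 hφ).1 v, h₂ (Set.union_subset_iff.1 hφ).2 v]
  | conj φ h => simp only [Realize, fun i => h i ((Set.iUnion_subset_iff.1 hφ) i) v]
  | @all n φ h =>
    have key : ∀ a : N, φ.Realize N (Fin.snoc v a) ↔
        φ.Realize M (Fin.snoc (fun i => (v i : M)) (a : M)) := by
      intro a
      refine (h ((Set.subset_insert _ _).trans hφ) _).trans ?_
      have : (fun i => ((Fin.snoc (α := fun _ => N) v a i : N) : M)) =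
          Fin.snoc (fun i => (v i : M)) (a : M) :=
        Fin.comp_snoc (Subtype.val : N → M) v a
      rw [this]
    simp only [Realize, key]
    refine ⟨fun h' => ?_, fun h' a => h' a⟩
    by_contra hcon
    obtain ⟨a, ha⟩ := hN n φ (hφ (Set.mem_insert _ _)) v (not_forall.1 hcon)
    exact ha (h' a)

end InfFormula

section LowenheimSkolem

variable {L : FirstOrder.Language.{0, 0}}

/-- The downward Löwenheim–Skolem theorem, for two sentences. -/
theorem exists_substructure_realize_iff [Countable L.Symbols] (M : Type u) [L.Structure M]
    [Nonempty M] (A : Set M) (φ ψ : InfSentence L) :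
    ∃ N : L.Substructure M, A ⊆ N ∧ #N ≤ max ℵ₀ #A ∧ Nonempty N ∧
      (φ.Realize N Fin.elim0 ↔ φ.Realize M Fin.elim0) ∧
      (ψ.Realize N Fin.elim0 ↔ ψ.Realize M Fin.elim0) := by
  classical
  set T := φ.matrices ∪ ψ.matrices with hT
  have hTc : T.Countable := φ.countable_matrices.union ψ.countable_matrices
  let _ := InfFormula.skolemStructure T M
  -- The extra generator keeps the hull non-empty when `A` is empty and there are no constants.
  let m : M := Classical.arbitrary M
  let K : (L.sum (InfFormula.skolemLanguage T)).Substructure M :=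
    FirstOrder.Language.Substructure.closure _ (insert m A)
  let N : L.Substructure M := FirstOrder.Language.LHom.sumInl.substructureReduct K
  have hKN : ∀ x, x ∈ N ↔ x ∈ K := fun x => Iff.rfl
  have hsub : insert m A ⊆ (K : Set M) := FirstOrder.Language.Substructure.subset_closure
  have hfun : Countable (Σ i, (L.sum (InfFormula.skolemLanguage T)).Functions i) := by
    have h1 : Countable (Σ i, (InfFormula.skolemLanguage T).Functions i) := by
      have : Countable T := hTc
      refine Function.Injective.countable
        (f := fun p : (Σ i, (InfFormula.skolemLanguage T).Functions i) =>
          (⟨⟨p.1 + 1, p.2.1⟩, p.2.2⟩ : T)) ?_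
      rintro ⟨n, f, hf⟩ ⟨k, g, hg⟩ h
      simp only [Subtype.mk.injEq, Sigma.mk.injEq, Nat.add_right_cancel_iff] at h
      obtain ⟨rfl, h⟩ := h
      obtain rfl := eq_of_heq h
      rfl
    have h2 : Countable (Σ i, L.Functions i) := inferInstance
    have h3 : ∀ i, Countable (L.Functions i ⊕ (InfFormula.skolemLanguage T).Functions i) := by
      intro i
      have := Function.Injective.countable
        (sigma_mk_injective (β := fun i => L.Functions i) (i := i))
      have := Function.Injective.countable
        (sigma_mk_injective (β := fun i => (InfFormula.skolemLanguage T).Functions i) (i := i))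
      infer_instance
    exact @instCountableSigma _ _ _ h3
  have hreal : ∀ χ : InfSentence L, χ.matrices ⊆ T →
      (χ.Realize N Fin.elim0 ↔ χ.Realize M Fin.elim0) := by
    intro χ hχ
    have := InfFormula.realize_substructure_iff N T ?_ χ hχ Fin.elim0
    · rwa [Subsingleton.elim (fun i : Fin 0 => ((Fin.elim0 i : N) : M)) Fin.elim0] at this
    · intro n θ hθ v hv
      let f : (L.sum (InfFormula.skolemLanguage T)).Functions n := Sum.inr ⟨θ, hθ⟩
      refine ⟨⟨FirstOrder.Language.Structure.funMap f fun i => (v i : M),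
        K.fun_mem f _ fun i => (v i).2⟩, ?_⟩
      exact Classical.epsilon_spec hv
  refine ⟨N, (Set.subset_insert _ _).trans hsub, ?_, ⟨⟨m, hsub (Set.mem_insert _ _)⟩⟩,
    hreal φ Set.subset_union_left, hreal ψ Set.subset_union_right⟩
  have h1 := FirstOrder.Language.Substructure.lift_card_closure_le
    (L := L.sum (InfFormula.skolemLanguage T)) (s := insert m A)
  have h2 : #(Σ i, (L.sum (InfFormula.skolemLanguage T)).Functions i) ≤ ℵ₀ :=
    Cardinal.mk_le_aleph0
  simp only [Cardinal.lift_id'] at h1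
  change #K ≤ _
  have h3 : #(insert m A : Set M) ≤ #A + 1 := Cardinal.mk_insert_le
  have h4 : Cardinal.lift.{u, 0} #(Σ i, (L.sum (InfFormula.skolemLanguage T)).Functions i) ≤ ℵ₀ :=
    Cardinal.lift_le_aleph0.2 h2
  have h1' : #K ≤ max ℵ₀ (#(insert m A : Set M) +
      Cardinal.lift.{u, 0} #(Σ i, (L.sum (InfFormula.skolemLanguage T)).Functions i)) := by
    simpa using h1
  refine h1'.trans (max_le (le_max_left _ _) ?_)
  refine (add_le_add h3 h4).trans ?_
  have hinf : ℵ₀ ≤ max ℵ₀ #A := le_max_left _ _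
  refine Cardinal.add_le_of_le hinf (Cardinal.add_le_of_le hinf (le_max_right _ _) ?_) hinf
  exact Cardinal.one_le_aleph0.trans hinf

theorem exists_countable_substructure [Countable L.Symbols] (M : Type u) [L.Structure M]
    [Nonempty M] (φ ψ : InfSentence L) :
    ∃ N : L.Substructure M, Countable N ∧ Nonempty N ∧
      (φ.Realize N Fin.elim0 ↔ φ.Realize M Fin.elim0) ∧
      (ψ.Realize N Fin.elim0 ↔ ψ.Realize M Fin.elim0) := by
  obtain ⟨N, -, hc, hne, h1, h2⟩ := exists_substructure_realize_iff M ∅ φ ψ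
  refine ⟨N, ?_, hne, h1, h2⟩
  rw [← Cardinal.mk_le_aleph0_iff]
  simpa using hc

/-- Models disagreeing about `ψ` would have countable substructures that still satisfy `φ` and still
disagree about `ψ`. This is why Löwenheim–Skolem is needed for two sentences at once. -/
theorem isCompleteSentence_of_countable_equiv [Countable L.Symbols] (φ : InfSentence L)
    (hφ : ∃ (M : Type u) (_ : L.Structure M), IsModel M φ)
    (h : ∀ (M N : Type u) [L.Structure M] [L.Structure N], Countable M → Countable N →
      IsModel M φ → IsModel N φ → Nonempty (M ≃[L] N)) : IsCompleteSentence.{u} φ := by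
  refine ⟨hφ, fun ψ => ?_⟩
  by_contra hcon
  simp only [not_or, not_forall] at hcon
  obtain ⟨⟨M, _, hM, hMψ⟩, ⟨N, _, hN, hNψ⟩⟩ := hcon
  have := hM.1
  have := hN.1
  obtain ⟨M', hMc, hMn, hM1, hM2⟩ := exists_countable_substructure M φ ψ
  obtain ⟨N', hNc, hNn, hN1, hN2⟩ := exists_countable_substructure N φ ψ
  obtain ⟨e⟩ := h N' M' hNc hMc ⟨hNn, hN1.2 hN.2⟩ ⟨hMn, hM1.2 hM.2⟩
  have hNψ' : ψ.Realize N Fin.elim0 := by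
    by_contra h'
    exact hNψ ⟨hN.1, h'⟩
  exact hMψ ⟨hM.1, hM2.1 (isModel_equiv e ⟨hNn, hN2.2 hNψ'⟩).2⟩

/-- A larger model would have a submodel of size exactly κ⁺, namely the hull of a subset of that
size. So excluding the single size κ⁺ bounds all models. -/
theorem mk_le_of_forall_model_ne_succ [Countable L.Symbols] (φ : InfSentence L) (κ : Cardinal.{u})
    (hκ : ℵ₀ ≤ κ) (h : ∀ (M : Type u) [L.Structure M], IsModel M φ → #M ≠ Order.succ κ)
    (M : Type u) [L.Structure M] (hM : IsModel M φ) : #M ≤ κ := by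
  by_contra hcon
  have := hM.1
  obtain ⟨A, hA⟩ := Cardinal.le_mk_iff_exists_set.1 (Order.succ_le_of_lt (not_le.1 hcon))
  obtain ⟨N, hAN, hc, hne, h1, -⟩ := exists_substructure_realize_iff M A φ φ
  refine h N ⟨hne, h1.2 hM.2⟩ (le_antisymm ?_ ?_)
  · rw [hA, max_eq_right (hκ.trans (Order.le_succ κ))] at hc
    exact hc
  · rw [← hA]
    exact Cardinal.mk_le_mk_of_subset hAN

end LowenheimSkolem

/-! ### Back and forth: countable models of a complete sentence are isomorphic. -/

section BackAndForth

/-- Extract a bijection from a directed family of partial bijections. -/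
theorem exists_equiv_of_ideal {P A B : Type*} [Preorder P] (I : Order.Ideal P)
    (R : P → A → B → Prop) (hmono : ∀ p q a b, p ≤ q → R p a b → R q a b)
    (hinj : ∀ p a b c d, R p a b → R p c d → (a = c ↔ b = d))
    (hforth : ∀ a, ∃ p ∈ I, ∃ b, R p a b) (hback : ∀ b, ∃ p ∈ I, ∃ a, R p a b) :
    ∃ e : A ≃ B, ∀ a, ∃ p ∈ I, R p a (e a) := by
  choose p hp f hf using hforth
  choose q hq g hg using hback
  have key : ∀ r ∈ I, ∀ s ∈ I, ∀ a b c d, R r a b → R s c d → (a = c ↔ b = d) := by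
    intro r hr s hs a b c d h1 h2
    obtain ⟨t, -, hrt, hst⟩ := I.directed r hr s hs
    exact hinj t a b c d (hmono r t a b hrt h1) (hmono s t c d hst h2)
  refine ⟨⟨f, g, fun a => ?_, fun b => ?_⟩, fun a => ⟨p a, hp a, hf a⟩⟩
  · exact (key _ (hq _) _ (hp _) _ _ _ _ (hg (f a)) (hf a)).2 rfl
  · exact (key _ (hp _) _ (hq _) _ _ _ _ (hf (g b)) (hg b)).1 rfl

theorem Order.Ideal.exists_upper_bound {P ι : Type*} [Preorder P] [Finite ι] (I : Order.Ideal P)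
    (f : ι → P) (hf : ∀ i, f i ∈ I) : ∃ q ∈ I, ∀ i, f i ≤ q := by
  have hdir := directedOn_iff_directed.1 I.directed
  have : Nonempty (I : Set P) := I.nonempty.to_subtype
  obtain ⟨z, hz⟩ := hdir.finite_le fun i => (⟨f i, hf i⟩ : (I : Set P))
  exact ⟨z, z.2, hz⟩

/-- Finite tuples of pairs that satisfy the same formulas on both sides. -/
structure EquivTuple (L : FirstOrder.Language.{0, 0}) (M N : Type u) [L.Structure M]
    [L.Structure N] where
  len : ℕ
  left : Fin len → M
  right : Fin len → N
  iff : ∀ φ : InfFormula L len, φ.Realize M left ↔ φ.Realize N right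

namespace EquivTuple

variable {L : FirstOrder.Language.{0, 0}} {M N : Type u} [L.Structure M] [L.Structure N]

def Rel (p : EquivTuple L M N) (a : M) (b : N) : Prop := ∃ i, p.left i = a ∧ p.right i = b

instance : Preorder (EquivTuple L M N) where
  le p q := ∀ a b, p.Rel a b → q.Rel a b
  le_refl _ _ _ h := h
  le_trans _ _ _ h₁ h₂ a b h := h₂ a b (h₁ a b h)

def swap (p : EquivTuple L M N) : EquivTuple L N M :=
  ⟨p.len, p.right, p.left, fun φ => (p.iff φ).symm⟩

/-- If every candidate b were refuted by some formula true of `a`, the conjunction of these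
formulas, countable because `N` is, would be realized over `p.left` but not over `p.right`. -/
theorem exists_forth [Countable N] [Nonempty N] (p : EquivTuple L M N) (a : M) :
    ∃ q, p ≤ q ∧ ∃ b, q.Rel a b := by
  have key : ∃ b : N, ∀ φ : InfFormula L (p.len + 1),
      φ.Realize M (Fin.snoc p.left a) ↔ φ.Realize N (Fin.snoc p.right b) := by
    by_contra hcon
    have hcon' : ∀ b : N, ∃ φ : InfFormula L (p.len + 1),
        φ.Realize M (Fin.snoc p.left a) ∧ ¬ φ.Realize N (Fin.snoc p.right b) := by
      intro b
      by_contra h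
      push Not at h
      refine hcon ⟨b, fun φ => ⟨h φ, fun hN => ?_⟩⟩
      by_contra hM
      exact h φ.not hM hN
    choose φ hφM hφN using hcon'
    obtain ⟨f, hf⟩ := exists_surjective_nat N
    have h1 : ¬ (InfFormula.all (InfFormula.conj fun i => φ (f i)).not).Realize M p.left :=
      fun h => h a fun i => hφM (f i)
    refine h1 ((p.iff _).2 fun b hb => ?_)
    obtain ⟨i, rfl⟩ := hf b
    exact hφN _ (hb i)
  obtain ⟨b, hb⟩ := key
  refine ⟨⟨p.len + 1, Fin.snoc p.left a, Fin.snoc p.right b, hb⟩, ?_,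
    b, Fin.last _, by simp, by simp⟩
  rintro c d ⟨i, rfl, rfl⟩
  exact ⟨i.castSucc, by simp, by simp⟩

theorem exists_back [Countable M] [Nonempty M] (p : EquivTuple L M N) (b : N) :
    ∃ q, p ≤ q ∧ ∃ a, q.Rel a b := by
  obtain ⟨q, hpq, a, i, h1, h2⟩ := p.swap.exists_forth b
  refine ⟨q.swap, ?_, a, i, h2, h1⟩
  rintro c d ⟨i, hc, hd⟩
  obtain ⟨j, h1, h2⟩ := hpq d c ⟨i, hd, hc⟩
  exact ⟨j, h2, h1⟩

theorem rel_inj (p : EquivTuple L M N) (a : M) (b : N) (c : M) (d : N) (h₁ : p.Rel a b)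
    (h₂ : p.Rel c d) : a = c ↔ b = d := by
  obtain ⟨i, rfl, rfl⟩ := h₁
  obtain ⟨j, rfl, rfl⟩ := h₂
  exact p.iff (.equal (.var i) (.var j))

end EquivTuple

open FirstOrder.Language in
/-- Countable structures with the same `L_{ω₁,ω}` theory are isomorphic. -/
theorem nonempty_equiv_of_realize_iff {L : FirstOrder.Language.{0, 0}} {M N : Type u}
    [L.Structure M] [L.Structure N] [Countable M] [Countable N] [Nonempty M] [Nonempty N]
    (h : ∀ φ : InfSentence L, φ.Realize M Fin.elim0 ↔ φ.Realize N Fin.elim0) :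
    Nonempty (M ≃[L] N) := by
  let _ := Encodable.ofCountable (M ⊕ N)
  let p₀ : EquivTuple L M N := ⟨0, Fin.elim0, Fin.elim0, h⟩
  let D : M ⊕ N → Order.Cofinal (EquivTuple L M N) := fun x =>
    ⟨{p | Sum.elim (fun a => ∃ b, p.Rel a b) (fun b => ∃ a, p.Rel a b) x}, fun p => by
      rcases x with a | b
      · obtain ⟨q, hpq, hq⟩ := p.exists_forth a
        exact ⟨q, hq, hpq⟩
      · obtain ⟨q, hpq, hq⟩ := p.exists_back b
        exact ⟨q, hq, hpq⟩⟩
  let I := Order.idealOfCofinals p₀ D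
  obtain ⟨e, he⟩ := exists_equiv_of_ideal I EquivTuple.Rel (fun p q a b hpq => hpq a b)
    EquivTuple.rel_inj
    (fun a => by
      obtain ⟨p, hp, hI⟩ := Order.cofinal_meets_idealOfCofinals p₀ D (Sum.inl a)
      exact ⟨p, hI, hp⟩)
    (fun b => by
      obtain ⟨p, hp, hI⟩ := Order.cofinal_meets_idealOfCofinals p₀ D (Sum.inr b)
      exact ⟨p, hI, hp⟩)
  choose f hf hfR using he
  have key : ∀ {n : ℕ} (v : Fin n → M), ∃ (p : EquivTuple L M N) (r : Fin n → Fin p.len),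
      ∀ i, p.left (r i) = v i ∧ p.right (r i) = e (v i) := by
    intro n v
    obtain ⟨q, -, hq⟩ := I.exists_upper_bound (fun i => f (v i)) fun i => hf _
    choose r hr using fun i => hq i _ _ (hfR (v i))
    exact ⟨q, r, hr⟩
  refine ⟨⟨e, fun {n} g v => ?_, fun {n} R v => ?_⟩⟩
  -- The value is listed together with its arguments, so that the equation between them is a formula
  -- about one tuple.
  · obtain ⟨p, r, hr⟩ := key (Fin.snoc v (Structure.funMap g v) : Fin (n + 1) → M)
    have h1 := p.iff (.equal (.var (r (Fin.last n)))
      (.func g fun i => .var (r i.castSucc)))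
    have hl := hr (Fin.last n)
    have hc := fun i : Fin n => hr i.castSucc
    simp only [Fin.snoc_last, Fin.snoc_castSucc] at hl hc
    simp only [InfFormula.Realize, Term.realize, hl, hc, true_iff] at h1
    exact h1
  · obtain ⟨p, r, hr⟩ := key v
    have h1 := p.iff (.rel R fun i => .var (r i))
    simp only [InfFormula.Realize, Term.realize, hr] at h1
    exact h1.symm

open FirstOrder.Language in
theorem IsCompleteSentence.nonempty_equiv {L : FirstOrder.Language.{0, 0}} {φ : InfSentence L}
    (hφ : IsCompleteSentence.{u} φ) {M N : Type u} [L.Structure M] [L.Structure N]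
    [Countable M] [Countable N] (hM : IsModel M φ) (hN : IsModel N φ) : Nonempty (M ≃[L] N) := by
  have := hM.1
  have := hN.1
  refine nonempty_equiv_of_realize_iff fun ψ => ?_
  rcases hφ.2 ψ with h | h
  · exact iff_of_true (h M hM).2 (h N hN).2
  · exact iff_of_false (h M hM).2 (h N hN).2

end BackAndForth

/-! ### Towers: axioms and cardinal bounds. -/

/-- A linear order `Y`, a projection `pr` of `X` to `U`, and for each `x` in `X` a partial
regressive function `F · x` on `Y`, which are generic for finite configurations. -/
structure IsTower {X Y U : Type*} (lt : Y → Y → Prop) (pr : X → U → Prop)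
    (F : Y → X → Y → Prop) : Prop where
  irrefl : ∀ a, ¬ lt a a
  trans : ∀ a b c, lt a b → lt b c → lt a c
  total : ∀ a b, lt a b ∨ a = b ∨ lt b a
  pr_exists : ∀ x, ∃ u, pr x u
  pr_unique : ∀ x u v, pr x u → pr x v → u = v
  F_lt : ∀ y x z, F y x z → lt z y
  F_unique : ∀ y x z w, F y x z → F y x w → z = w
  locally_finite : ∀ (s : Finset X) (y : Y), ∃ t : Finset Y, y ∈ t ∧
    ∀ y' ∈ t, ∀ x ∈ s, ∀ z, F y' x z → z ∈ t
  extend_Y : ∀ (s : Finset X) (D E : Finset Y) (G : X → Y → Prop),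
    (∀ d ∈ D, ∀ e ∈ E, lt d e) → (∀ x ∈ s, ∀ z, G x z → z ∈ D) →
    (∀ x ∈ s, ∀ z w, G x z → G x w → z = w) →
    ∃ y, (∀ d ∈ D, lt d y) ∧ (∀ e ∈ E, lt y e) ∧ ∀ x ∈ s, ∀ z, F y x z ↔ G x z
  extend_X : ∀ (u : U) (s : Finset X) (t : Finset Y) (G : Y → Y → Prop),
    (∀ y ∈ t, ∀ z, G y z → z ∈ t ∧ lt z y) →
    (∀ y ∈ t, ∀ z w, G y z → G y w → z = w) →
    ∃ x, x ∉ s ∧ pr x u ∧ ∀ y ∈ t, ∀ z, F y x z ↔ G y z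
  infinite_U : Infinite U

namespace IsTower

section Bounds

variable {X Y U : Type u} {lt : Y → Y → Prop} {pr : X → U → Prop} {F : Y → X → Y → Prop}

/-- Genericity in X, applied to the one-point partial function sending `y` to `z`. Since F is
single-valued, choosing such an x for each `z` injects the predecessors of `y` into X. -/
theorem exists_F (h : IsTower lt pr F) {y z : Y} (hzy : lt z y) : ∃ x, F y x z := by
  classical
  have := h.infinite_U
  obtain ⟨x, -, -, hx⟩ := h.extend_X (Classical.arbitrary U) ∅ {y, z} (fun a b => a = y ∧ b = z)
    (by rintro a - b ⟨rfl, rfl⟩; exact ⟨by simp, hzy⟩)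
    (by rintro a - b c ⟨-, rfl⟩ ⟨-, rfl⟩; rfl)
  exact ⟨x, (hx y (by simp) z).2 ⟨rfl, rfl⟩⟩

theorem mk_pred_le (h : IsTower lt pr F) (y : Y) : #{z // lt z y} ≤ #X := by
  choose f hf using fun z : {z // lt z y} => h.exists_F z.2
  refine Cardinal.mk_le_of_injective (f := f) fun a b hab => Subtype.ext ?_
  exact h.F_unique y (f a) a b (hf a) (hab ▸ hf b)

theorem mk_U_le (h : IsTower lt pr F) : #U ≤ #X := by
  have key : ∀ u, ∃ x, pr x u := fun u => by
    obtain ⟨x, -, hx, -⟩ := h.extend_X u ∅ ∅ (fun _ _ => False) (by simp) (by simp)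
    exact ⟨x, hx⟩
  choose f hf using key
  refine Cardinal.mk_le_of_injective (f := f) fun a b hab => ?_
  exact h.pr_unique (f a) a b (hf a) (hab ▸ hf b)

theorem aleph0_le_mk_X (h : IsTower lt pr F) : ℵ₀ ≤ #X := by
  have := h.infinite_U
  exact (Cardinal.aleph0_le_mk U).trans h.mk_U_le

/-- A linear order all of whose proper initial segments have size at most `λ` has size at
most `λ⁺`. -/
theorem mk_Y_le (h : IsTower lt pr F) : #Y ≤ Order.succ #X := by
  by_contra hcon
  have hlt := not_le.1 hcon
  obtain ⟨A, hA⟩ := Cardinal.le_mk_iff_exists_set.1 hlt.le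
  have hX := h.aleph0_le_mk_X
  -- A subset of size |X|⁺ cannot lie below one point, so it is cofinal and Y is a union of |X|⁺
  -- segments of size at most |X|.
  have hcof : ∀ y, ∃ a ∈ A, ¬ lt a y := by
    intro y
    by_contra hA'
    push Not at hA'
    have h1 : #A ≤ #{z // lt z y} := Cardinal.mk_le_mk_of_subset (t := {z | lt z y}) hA'
    rw [hA] at h1
    exact (Order.lt_succ #X).not_ge (h1.trans (h.mk_pred_le y))
  have hunion : (Set.univ : Set Y) ⊆ ⋃ a : A, {z | lt z a} ∪ {(a : Y)} := by
    intro y _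
    obtain ⟨a, ha, hay⟩ := hcof y
    refine Set.mem_iUnion.2 ⟨⟨a, ha⟩, ?_⟩
    rcases h.total y a with h' | rfl | h'
    · exact Or.inl h'
    · exact Or.inr rfl
    · exact absurd h' hay
  refine hcon ?_
  rw [← Cardinal.mk_univ]
  have hseg : ∀ a : A, #↥({z | lt z a} ∪ {(a : Y)}) ≤ Order.succ #X := by
    intro a
    refine (Cardinal.mk_union_le _ _).trans ?_
    refine Cardinal.add_le_of_le (hX.trans (Order.le_succ _))
      ((h.mk_pred_le a).trans (Order.le_succ _)) ?_
    rw [Cardinal.mk_singleton]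
    exact Cardinal.one_le_aleph0.trans (hX.trans (Order.le_succ _))
  refine (Cardinal.mk_le_mk_of_subset hunion).trans ((Cardinal.mk_iUnion_le _).trans ?_)
  rw [hA]
  exact Cardinal.mul_le_of_le (hX.trans (Order.le_succ _)) le_rfl (ciSup_le' hseg)

end Bounds

section Closure

variable {X Y U : Type*} {lt : Y → Y → Prop} {pr : X → U → Prop} {F : Y → X → Y → Prop}

theorem exists_closed (h : IsTower lt pr F) (s : Finset X) (t : Finset Y) :
    ∃ w : Finset Y, t ⊆ w ∧ ∀ y ∈ w, ∀ x ∈ s, ∀ z, F y x z → z ∈ w := by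
  classical
  choose f hf hf' using h.locally_finite s
  refine ⟨t.biUnion f, fun y hy => Finset.mem_biUnion.2 ⟨y, hy, hf y⟩, ?_⟩
  intro y hy x hx z hz
  obtain ⟨a, ha, hya⟩ := Finset.mem_biUnion.1 hy
  exact Finset.mem_biUnion.2 ⟨a, ha, hf' a y hya x hx z hz⟩

theorem asymm (h : IsTower lt pr F) {a b : Y} (h1 : lt a b) (h2 : lt b a) : False :=
  h.irrefl a (h.trans a b a h1 h2)

/-- Induction over a finite set closed under some of the regressive functions. -/
theorem closed_induction (h : IsTower lt pr F) (s : Set X) {p : Finset Y → Prop} (h0 : p ∅)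
    (hstep : ∀ (t : Finset Y) (y : Y), p t → (∀ x ∈ s, ∀ z, F y x z → z ∈ t) →
      ∀ [DecidableEq Y], p (insert y t))
    (w : Finset Y) (hw : ∀ y ∈ w, ∀ x ∈ s, ∀ z, F y x z → z ∈ w) : p w := by
  classical
  have : IsStrictTotalOrder Y lt :=
    { irrefl := h.irrefl
      trans := h.trans
      trichotomous := fun a b h1 h2 => ((h.total a b).resolve_left h1).resolve_right h2 }
  let _ : LinearOrder Y := linearOrderOfSTO lt
  induction w using Finset.induction_on_max with
  | empty => exact h0
  | insert a t hmax ih =>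
    have hlt : ∀ x ∈ t, lt x a := hmax
    convert hstep t a (ih fun y hy x hx z hz => ?_) (fun x hx z hz => ?_)
    -- Values lie below their arguments, so the maximum is no value of a smaller element, and
    -- removing it leaves a closed set.
    · rcases Finset.mem_insert.1 (hw y (Finset.mem_insert_of_mem hy) x hx z hz) with rfl | h'
      · exact (h.asymm (h.F_lt _ _ _ hz) (hlt y hy)).elim
      · exact h'
    · rcases Finset.mem_insert.1 (hw a (Finset.mem_insert_self _ _) x hx z hz) with rfl | h'
      · exact (h.irrefl _ (h.F_lt _ _ _ hz)).elim
      · exact h'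

end Closure

end IsTower

/-! ### Categoricity of countable towers. -/

/-- A finite partial isomorphism between two towers, which respects the bijection `σ`. -/
structure TowerPartialIso {X Y U X' Y' U' : Type*} (lt : Y → Y → Prop) (pr : X → U → Prop)
    (F : Y → X → Y → Prop) (lt' : Y' → Y' → Prop) (pr' : X' → U' → Prop)
    (F' : Y' → X' → Y' → Prop) (σ : U ≃ U') where
  onX : Finset (X × X')
  onY : Finset (Y × Y')
  inj_X : ∀ a ∈ onX, ∀ b ∈ onX, a.1 = b.1 ↔ a.2 = b.2
  inj_Y : ∀ a ∈ onY, ∀ b ∈ onY, a.1 = b.1 ↔ a.2 = b.2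
  lt_iff : ∀ a ∈ onY, ∀ b ∈ onY, lt a.1 b.1 ↔ lt' a.2 b.2
  pr_iff : ∀ a ∈ onX, ∀ u, pr a.1 u ↔ pr' a.2 (σ u)
  -- This also forces domain and range in Y to be closed under the functions of the listed elements
  -- of X: a value outside the domain could not be matched later, its counterpart being already
  -- determined.
  F_compat : ∀ a ∈ onY, ∀ b ∈ onX, (∃ c ∈ onY, F a.1 b.1 c.1 ∧ F' a.2 b.2 c.2) ∨
    ((∀ z, ¬ F a.1 b.1 z) ∧ ∀ z, ¬ F' a.2 b.2 z)

namespace TowerPartialIso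

variable {X Y U X' Y' U' : Type*} {lt : Y → Y → Prop} {pr : X → U → Prop}
    {F : Y → X → Y → Prop} {lt' : Y' → Y' → Prop} {pr' : X' → U' → Prop}
    {F' : Y' → X' → Y' → Prop} {σ : U ≃ U'}

instance : Preorder (TowerPartialIso lt pr F lt' pr' F' σ) where
  le p q := p.onX ⊆ q.onX ∧ p.onY ⊆ q.onY
  le_refl _ := ⟨subset_rfl, subset_rfl⟩
  le_trans _ _ _ h₁ h₂ := ⟨h₁.1.trans h₂.1, h₁.2.trans h₂.2⟩

instance : Inhabited (TowerPartialIso lt pr F lt' pr' F' σ) :=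
  ⟨⟨∅, ∅, by simp, by simp, by simp, by simp, by simp⟩⟩

open Classical in
/-- The inverse partial isomorphism. -/
noncomputable def symm (p : TowerPartialIso lt pr F lt' pr' F' σ) :
    TowerPartialIso lt' pr' F' lt pr F σ.symm where
  onX := p.onX.image Prod.swap
  onY := p.onY.image Prod.swap
  inj_X := by
    simp only [Finset.forall_mem_image, Prod.fst_swap, Prod.snd_swap]
    exact fun a ha b hb => (p.inj_X a ha b hb).symm
  inj_Y := by
    simp only [Finset.forall_mem_image, Prod.fst_swap, Prod.snd_swap]
    exact fun a ha b hb => (p.inj_Y a ha b hb).symm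
  lt_iff := by
    simp only [Finset.forall_mem_image, Prod.fst_swap, Prod.snd_swap]
    exact fun a ha b hb => (p.lt_iff a ha b hb).symm
  pr_iff := by
    simp only [Finset.forall_mem_image, Prod.fst_swap, Prod.snd_swap]
    intro a ha u
    rw [p.pr_iff a ha, Equiv.apply_symm_apply]
  F_compat := by
    simp only [Finset.forall_mem_image, Finset.exists_mem_image, Prod.fst_swap, Prod.snd_swap]
    intro a ha b hb
    rcases p.F_compat a ha b hb with ⟨c, hc, h1, h2⟩ | ⟨h1, h2⟩
    · exact Or.inl ⟨c, hc, h2, h1⟩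
    · exact Or.inr ⟨h2, h1⟩

theorem mem_symm_onX (p : TowerPartialIso lt pr F lt' pr' F' σ) (x : X) (x' : X') :
    (x', x) ∈ p.symm.onX ↔ (x, x') ∈ p.onX := by
  simp [symm]

theorem mem_symm_onY (p : TowerPartialIso lt pr F lt' pr' F' σ) (y : Y) (y' : Y') :
    (y', y) ∈ p.symm.onY ↔ (y, y') ∈ p.onY := by
  simp [symm]

theorem le_symm {p : TowerPartialIso lt pr F lt' pr' F' σ}
    {q : TowerPartialIso lt' pr' F' lt pr F σ.symm} (h : p.symm ≤ q) :
    ∃ r : TowerPartialIso lt pr F lt' pr' F' σ, p ≤ r ∧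
      (∀ x x', (x, x') ∈ r.onX ↔ (x', x) ∈ q.onX) ∧
      ∀ y y', (y, y') ∈ r.onY ↔ (y', y) ∈ q.onY := by
  refine ⟨q.symm, ⟨?_, ?_⟩, fun x x' => q.mem_symm_onX _ _, fun y y' => q.mem_symm_onY _ _⟩
  · rintro ⟨x, x'⟩ hx
    exact (q.mem_symm_onX _ _).2 (h.1 ((p.mem_symm_onX _ _).2 hx))
  · rintro ⟨y, y'⟩ hy
    exact (q.mem_symm_onY _ _).2 (h.2 ((p.mem_symm_onY _ _).2 hy))

/-- The values at `y` already have images, so the position of `y` and its behaviour under the listed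
x translate into a finite cut and a finite partial function on the other side, which `extend_Y`
realizes. -/
theorem exists_extend_Y_one (hT : IsTower lt pr F) (hT' : IsTower lt' pr' F')
    (p : TowerPartialIso lt pr F lt' pr' F' σ) (y : Y)
    (hy : ∀ a ∈ p.onX, ∀ z, F y a.1 z → ∃ b ∈ p.onY, b.1 = z) :
    ∃ q, p ≤ q ∧ q.onX = p.onX ∧ ∀ z, (∃ b ∈ q.onY, b.1 = z) ↔ z = y ∨ ∃ b ∈ p.onY, b.1 = z := by
  classical
  by_cases hmem : ∃ b ∈ p.onY, b.1 = y
  · refine ⟨p, le_rfl, rfl, fun z => ⟨Or.inr, ?_⟩⟩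
    rintro (rfl | h)
    exacts [hmem, h]
  obtain ⟨y', hD, hE, hG⟩ := hT'.extend_Y (p.onX.image Prod.snd)
    ((p.onY.filter fun b => lt b.1 y).image Prod.snd)
    ((p.onY.filter fun b => lt y b.1).image Prod.snd)
    (fun x' z' => ∃ a ∈ p.onX, ∃ b ∈ p.onY, a.2 = x' ∧ b.2 = z' ∧ F y a.1 b.1)
    (by
      simp only [Finset.forall_mem_image, Finset.mem_filter]
      rintro a ⟨ha, hay⟩ b ⟨hb, hyb⟩
      exact (p.lt_iff a ha b hb).1 (hT.trans _ _ _ hay hyb))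
    (by
      rintro x' - z' ⟨a, ha, b, hb, rfl, rfl, hF⟩
      exact Finset.mem_image_of_mem _ (Finset.mem_filter.2 ⟨hb, hT.F_lt _ _ _ hF⟩))
    (by
      rintro x' - z' w' ⟨a, ha, b, hb, rfl, rfl, hF⟩ ⟨c, hc, d, hd, hac, rfl, hF'⟩
      have h1 := (p.inj_X c hc a ha).2 hac
      rw [h1] at hF'
      exact (p.inj_Y b hb d hd).1 (hT.F_unique _ _ _ _ hF hF'))
  simp only [Finset.forall_mem_image, Finset.mem_filter, and_imp] at hD hE hG
  have hlt : ∀ b ∈ p.onY, (lt b.1 y ∧ lt' b.2 y') ∨ (lt y b.1 ∧ lt' y' b.2) := by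
    intro b hb
    rcases hT.total b.1 y with h | h | h
    · exact Or.inl ⟨h, hD hb h⟩
    · exact (hmem ⟨b, hb, h⟩).elim
    · exact Or.inr ⟨h, hE hb h⟩
  have hlt1 : ∀ b ∈ p.onY, (lt b.1 y ↔ lt' b.2 y') := by
    intro b hb
    rcases hlt b hb with ⟨h1, h2⟩ | ⟨h1, h2⟩
    · exact iff_of_true h1 h2
    · exact iff_of_false (fun h => hT.asymm h1 h) fun h => hT'.asymm h2 h
  have hlt2 : ∀ b ∈ p.onY, (lt y b.1 ↔ lt' y' b.2) := by
    intro b hb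
    rcases hlt b hb with ⟨h1, h2⟩ | ⟨h1, h2⟩
    · exact iff_of_false (fun h => hT.asymm h1 h) fun h => hT'.asymm h2 h
    · exact iff_of_true h1 h2
  have hne : ∀ b ∈ p.onY, b.1 ≠ y ∧ b.2 ≠ y' := by
    intro b hb
    refine ⟨fun h => hmem ⟨b, hb, h⟩, fun h => ?_⟩
    rcases hlt b hb with ⟨-, h2⟩ | ⟨-, h2⟩ <;> rw [h] at h2 <;> exact hT'.irrefl _ h2
  refine ⟨⟨p.onX, insert (y, y') p.onY, p.inj_X, ?_, ?_, p.pr_iff, ?_⟩,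
    ⟨subset_rfl, Finset.subset_insert _ _⟩, rfl, fun z => ?_⟩
  · simp only [Finset.forall_mem_insert]
    exact ⟨⟨by simp, fun b hb => iff_of_false (hne b hb).1.symm (hne b hb).2.symm⟩,
      fun b hb => ⟨iff_of_false (hne b hb).1 (hne b hb).2, p.inj_Y b hb⟩⟩
  · simp only [Finset.forall_mem_insert]
    exact ⟨⟨iff_of_false (hT.irrefl _) (hT'.irrefl _), fun b hb => hlt2 b hb⟩,
      fun b hb => ⟨hlt1 b hb, p.lt_iff b hb⟩⟩
  · simp only [Finset.forall_mem_insert]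
    refine ⟨fun a ha => ?_, fun b hb a ha => ?_⟩
    · by_cases hz : ∃ z, F y a.1 z
      · obtain ⟨z, hz⟩ := hz
        obtain ⟨b, hb, rfl⟩ := hy a ha z hz
        exact Or.inl ⟨b, Finset.mem_insert_of_mem hb, hz,
          (hG ha b.2).2 ⟨a, ha, b, hb, rfl, rfl, hz⟩⟩
      · refine Or.inr ⟨not_exists.1 hz, fun z' hz' => ?_⟩
        obtain ⟨c, hc, b, hb, hca, rfl, hF⟩ := (hG ha z').1 hz'
        rw [(p.inj_X c hc a ha).2 hca] at hF
        exact hz ⟨_, hF⟩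
    · rcases p.F_compat b hb a ha with ⟨c, hc, h⟩ | h
      · exact Or.inl ⟨c, Finset.mem_insert_of_mem hc, h⟩
      · exact Or.inr h
  · simp only [Finset.mem_insert, exists_eq_or_imp]
    rw [eq_comm]

/-- A closed finite set can be added one point at a time in increasing order: the values of each
point then precede it. -/
theorem exists_extend_Y (hT : IsTower lt pr F) (hT' : IsTower lt' pr' F')
    (p : TowerPartialIso lt pr F lt' pr' F' σ) (w : Finset Y)
    (hw : ∀ y ∈ w, ∀ a ∈ p.onX, ∀ z, F y a.1 z → z ∈ w) :
    ∃ q, p ≤ q ∧ q.onX = p.onX ∧ ∀ z, (∃ b ∈ q.onY, b.1 = z) ↔ z ∈ w ∨ ∃ b ∈ p.onY, b.1 = z := by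
  refine hT.closed_induction {x | ∃ a ∈ p.onX, a.1 = x} (p := fun w => ∃ q, p ≤ q ∧ q.onX = p.onX ∧
    ∀ z, (∃ b ∈ q.onY, b.1 = z) ↔ z ∈ w ∨ ∃ b ∈ p.onY, b.1 = z) ?_ ?_ w ?_
  · exact ⟨p, le_rfl, rfl, by simp⟩
  · rintro t y ⟨q, hpq, hqX, hqY⟩ hy _
    obtain ⟨r, hqr, hrX, hrY⟩ := exists_extend_Y_one hT hT' q y fun a ha z hz =>
      (hqY z).2 (Or.inl (hy a.1 ⟨a, hqX ▸ ha, rfl⟩ z hz))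
    refine ⟨r, hpq.trans hqr, hrX.trans hqX, fun z => ?_⟩
    rw [hrY, hqY, Finset.mem_insert, or_assoc]
  · rintro y hy x ⟨a, ha, rfl⟩ z hz
    exact hw y hy a ha z hz

theorem exists_forth_Y (hT : IsTower lt pr F) (hT' : IsTower lt' pr' F')
    (p : TowerPartialIso lt pr F lt' pr' F' σ) (y : Y) :
    ∃ q, p ≤ q ∧ ∃ y', (y, y') ∈ q.onY := by
  classical
  obtain ⟨w, hyw, hw⟩ := hT.locally_finite (p.onX.image Prod.fst) y
  obtain ⟨q, hpq, -, hq⟩ := exists_extend_Y hT hT' p w fun y hy a ha =>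
    hw y hy a.1 (Finset.mem_image_of_mem _ ha)
  obtain ⟨⟨_, y'⟩, hb, rfl⟩ := (hq y).2 (Or.inl hyw)
  exact ⟨q, hpq, y', hb⟩

theorem exists_forth_X (hT : IsTower lt pr F) (hT' : IsTower lt' pr' F')
    (p : TowerPartialIso lt pr F lt' pr' F' σ) (x : X) :
    ∃ q, p ≤ q ∧ ∃ x', (x, x') ∈ q.onX := by
  classical
  by_cases hmem : ∃ a ∈ p.onX, a.1 = x
  · obtain ⟨⟨_, x'⟩, ha, rfl⟩ := hmem
    exact ⟨p, le_rfl, x', ha⟩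
  -- Before `x` can be added, the domain in Y is closed under the function of `x` as well as the old
  -- ones.
  obtain ⟨w, htw, hw⟩ := hT.exists_closed (insert x (p.onX.image Prod.fst)) (p.onY.image Prod.fst)
  obtain ⟨q, hpq, hqX, hqY⟩ := exists_extend_Y hT hT' p w fun y hy a ha =>
    hw y hy a.1 (Finset.mem_insert_of_mem (Finset.mem_image_of_mem _ ha))
  have hq : ∀ z, (∃ b ∈ q.onY, b.1 = z) ↔ z ∈ w := by
    intro z
    rw [hqY, or_iff_left_of_imp]
    rintro ⟨b, hb, rfl⟩
    exact htw (Finset.mem_image_of_mem _ hb)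
  have hqF : ∀ b ∈ q.onY, ∀ z, F b.1 x z → ∃ c ∈ q.onY, c.1 = z := fun b hb z hz =>
    (hq z).2 (hw b.1 ((hq _).1 ⟨b, hb, rfl⟩) x (Finset.mem_insert_self _ _) z hz)
  obtain ⟨u, hu⟩ := hT.pr_exists x
  -- The projection of `x'` is prescribed as well; this is how the bijection `σ` is respected.
  obtain ⟨x', hx's, hx'u, hx'F⟩ := hT'.extend_X (σ u) (q.onX.image Prod.snd) (q.onY.image Prod.snd)
    (fun y' z' => ∃ a ∈ q.onY, ∃ b ∈ q.onY, a.2 = y' ∧ b.2 = z' ∧ F a.1 x b.1)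
    (by
      rintro y' - z' ⟨a, ha, b, hb, rfl, rfl, hF⟩
      exact ⟨Finset.mem_image_of_mem _ hb, (q.lt_iff b hb a ha).1 (hT.F_lt _ _ _ hF)⟩)
    (by
      rintro y' - z' w' ⟨a, ha, b, hb, rfl, rfl, hF⟩ ⟨c, hc, d, hd, hac, rfl, hF'⟩
      rw [(q.inj_Y c hc a ha).2 hac] at hF'
      exact (q.inj_Y b hb d hd).1 (hT.F_unique _ _ _ _ hF hF'))
  simp only [Finset.forall_mem_image] at hx'F
  have hne : ∀ a ∈ q.onX, a.1 ≠ x ∧ a.2 ≠ x' := by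
    intro a ha
    refine ⟨fun h => hmem ⟨a, hqX ▸ ha, h⟩, fun h => hx's ?_⟩
    rw [← h]
    exact Finset.mem_image_of_mem _ ha
  refine ⟨⟨insert (x, x') q.onX, q.onY, ?_, q.inj_Y, q.lt_iff, ?_, ?_⟩,
    hpq.trans ⟨Finset.subset_insert _ _, subset_rfl⟩, x', Finset.mem_insert_self _ _⟩
  · simp only [Finset.forall_mem_insert]
    exact ⟨⟨by simp, fun b hb => iff_of_false (hne b hb).1.symm (hne b hb).2.symm⟩,
      fun b hb => ⟨iff_of_false (hne b hb).1 (hne b hb).2, q.inj_X b hb⟩⟩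
  · simp only [Finset.forall_mem_insert]
    refine ⟨fun v => ⟨fun hv => ?_, fun hv => ?_⟩, q.pr_iff⟩
    · rwa [hT.pr_unique x v u hv hu]
    · rwa [σ.injective (hT'.pr_unique x' (σ v) (σ u) hv hx'u)]
  · simp only [Finset.forall_mem_insert]
    refine fun b hb => ⟨?_, q.F_compat b hb⟩
    by_cases hz : ∃ z, F b.1 x z
    · obtain ⟨z, hz⟩ := hz
      obtain ⟨c, hc, rfl⟩ := hqF b hb z hz
      exact Or.inl ⟨c, hc, hz, (hx'F hb _).2 ⟨b, hb, c, hc, rfl, rfl, hz⟩⟩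
    · refine Or.inr ⟨not_exists.1 hz, fun z' hz' => ?_⟩
      obtain ⟨a, ha, c, hc, hab, rfl, hF⟩ := (hx'F hb z').1 hz'
      rw [(q.inj_Y a ha b hb).2 hab] at hF
      exact hz ⟨_, hF⟩

end TowerPartialIso

/-- Countable towers are isomorphic, over any bijection of their sorts `U`. -/
theorem IsTower.exists_equiv {X Y U X' Y' U' : Type*} {lt : Y → Y → Prop} {pr : X → U → Prop}
    {F : Y → X → Y → Prop} {lt' : Y' → Y' → Prop} {pr' : X' → U' → Prop}
    {F' : Y' → X' → Y' → Prop} [Countable X] [Countable Y] [Countable X'] [Countable Y']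
    (hT : IsTower lt pr F) (hT' : IsTower lt' pr' F') (σ : U ≃ U') :
    ∃ (f : X ≃ X') (g : Y ≃ Y'), (∀ a b, lt a b ↔ lt' (g a) (g b)) ∧
      (∀ x u, pr x u ↔ pr' (f x) (σ u)) ∧ ∀ y x z, F y x z ↔ F' (g y) (f x) (g z) := by
  let P := TowerPartialIso lt pr F lt' pr' F' σ
  let _ := Encodable.ofCountable ((X ⊕ X') ⊕ (Y ⊕ Y'))
  let D : (X ⊕ X') ⊕ (Y ⊕ Y') → Order.Cofinal P := fun i =>
    ⟨{p | Sum.elim (Sum.elim (fun x => ∃ x', (x, x') ∈ p.onX) (fun x' => ∃ x, (x, x') ∈ p.onX))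
      (Sum.elim (fun y => ∃ y', (y, y') ∈ p.onY) (fun y' => ∃ y, (y, y') ∈ p.onY)) i}, fun p => by
      rcases i with (x | x') | (y | y')
      · obtain ⟨q, hpq, hq⟩ := p.exists_forth_X hT hT' x
        exact ⟨q, hq, hpq⟩
      · obtain ⟨q, hpq, x, hq⟩ := p.symm.exists_forth_X hT' hT x'
        obtain ⟨r, hpr, hrX, -⟩ := TowerPartialIso.le_symm hpq
        exact ⟨r, ⟨x, (hrX _ _).2 hq⟩, hpr⟩
      · obtain ⟨q, hpq, hq⟩ := p.exists_forth_Y hT hT' y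
        exact ⟨q, hq, hpq⟩
      · obtain ⟨q, hpq, y, hq⟩ := p.symm.exists_forth_Y hT' hT y'
        obtain ⟨r, hpr, -, hrY⟩ := TowerPartialIso.le_symm hpq
        exact ⟨r, ⟨y, (hrY _ _).2 hq⟩, hpr⟩⟩
  let I := Order.idealOfCofinals default D
  have hmeet := fun i => Order.cofinal_meets_idealOfCofinals default D i
  obtain ⟨f, hf⟩ := exists_equiv_of_ideal I (fun p x x' => (x, x') ∈ p.onX)
    (fun p q a b hpq h => hpq.1 h) (fun p a b c d h1 h2 => p.inj_X _ h1 _ h2)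
    (fun x => by
      obtain ⟨p, hp, hI⟩ := hmeet (Sum.inl (Sum.inl x))
      exact ⟨p, hI, hp⟩)
    (fun x' => by
      obtain ⟨p, hp, hI⟩ := hmeet (Sum.inl (Sum.inr x'))
      exact ⟨p, hI, hp⟩)
  obtain ⟨g, hg⟩ := exists_equiv_of_ideal I (fun p y y' => (y, y') ∈ p.onY)
    (fun p q a b hpq h => hpq.2 h) (fun p a b c d h1 h2 => p.inj_Y _ h1 _ h2)
    (fun y => by
      obtain ⟨p, hp, hI⟩ := hmeet (Sum.inr (Sum.inl y))
      exact ⟨p, hI, hp⟩)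
    (fun y' => by
      obtain ⟨p, hp, hI⟩ := hmeet (Sum.inr (Sum.inr y'))
      exact ⟨p, hI, hp⟩)
  have hF : ∀ y x, ∃ p ∈ I, (x, f x) ∈ p.onX ∧ (y, g y) ∈ p.onY := by
    intro y x
    obtain ⟨p, hp, hx⟩ := hf x
    obtain ⟨q, hq, hy⟩ := hg y
    obtain ⟨r, hr, hpr, hqr⟩ := I.directed p hp q hq
    exact ⟨r, hr, hpr.1 hx, hqr.2 hy⟩
  have hgp : ∀ p ∈ I, ∀ c ∈ p.onY, c.2 = g c.1 := by
    intro p hp c hc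
    obtain ⟨q, hq, hy⟩ := hg c.1
    obtain ⟨r, hr, hpr, hqr⟩ := I.directed p hp q hq
    exact (r.inj_Y _ (hpr.2 hc) _ (hqr.2 hy)).1 rfl
  refine ⟨f, g, fun a b => ?_, fun x u => ?_, fun y x z => ?_⟩
  · obtain ⟨p, hp, ha⟩ := hg a
    obtain ⟨q, hq, hb⟩ := hg b
    obtain ⟨r, hr, hpr, hqr⟩ := I.directed p hp q hq
    exact r.lt_iff _ (hpr.2 ha) _ (hqr.2 hb)
  · obtain ⟨p, hp, hx⟩ := hf x
    exact p.pr_iff _ hx u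
  · obtain ⟨p, hp, hx, hy⟩ := hF y x
    rcases p.F_compat _ hy _ hx with ⟨c, hc, h1, h2⟩ | ⟨h1, h2⟩
    · have h3 := hgp p hp c hc
      simp only at h1 h2
      rw [h3] at h2
      constructor
      · intro h
        rwa [hT.F_unique _ _ _ _ h h1]
      · intro h
        rwa [g.injective (hT'.F_unique _ _ _ _ h h2)]
    · exact iff_of_false (h1 z) (h2 _)

/-- Transport of a tower along bijections. -/
theorem IsTower.of_equiv {X Y U X' Y' U' : Type*} {lt : Y → Y → Prop} {pr : X → U → Prop}
    {F : Y → X → Y → Prop} {lt' : Y' → Y' → Prop} {pr' : X' → U' → Prop}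
    {F' : Y' → X' → Y' → Prop} (hT : IsTower lt pr F) (f : X' ≃ X) (g : Y' ≃ Y) (σ : U' ≃ U)
    (hlt : ∀ a b, lt' a b ↔ lt (g a) (g b)) (hpr : ∀ x u, pr' x u ↔ pr (f x) (σ u))
    (hF : ∀ y x z, F' y x z ↔ F (g y) (f x) (g z)) : IsTower lt' pr' F' where
  irrefl a := by rw [hlt]; exact hT.irrefl _
  trans a b c := by simp only [hlt]; exact hT.trans _ _ _
  total a b := by simpa only [hlt, g.injective.eq_iff] using hT.total (g a) (g b)
  pr_exists x := by
    obtain ⟨u, hu⟩ := hT.pr_exists (f x)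
    exact ⟨σ.symm u, by rwa [hpr, σ.apply_symm_apply]⟩
  pr_unique x u v := by
    simp only [hpr]
    exact fun h1 h2 => σ.injective (hT.pr_unique _ _ _ h1 h2)
  F_lt y x z := by simp only [hF, hlt]; exact hT.F_lt _ _ _
  F_unique y x z w := by
    simp only [hF]
    exact fun h1 h2 => g.injective (hT.F_unique _ _ _ _ h1 h2)
  locally_finite s y := by
    obtain ⟨t, hy, ht⟩ := hT.locally_finite (s.map f.toEmbedding) (g y)
    refine ⟨t.map g.symm.toEmbedding, by simpa [Finset.mem_map_equiv] using hy, ?_⟩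
    intro y' hy' x hx z hz
    rw [Finset.mem_map_equiv, Equiv.symm_symm] at hy' ⊢
    exact ht _ hy' (f x) (Finset.mem_map_of_mem _ hx) _ ((hF _ _ _).1 hz)
  extend_Y s D E G h1 h2 h3 := by
    obtain ⟨y, hyD, hyE, hy⟩ := hT.extend_Y (s.map f.toEmbedding) (D.map g.toEmbedding)
      (E.map g.toEmbedding) (fun x z => G (f.symm x) (g.symm z))
      (by simpa only [Finset.forall_mem_map, Equiv.coe_toEmbedding, hlt] using h1)
      (by
        intro x hx z hz
        rw [Finset.mem_map_equiv] at hx ⊢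
        exact h2 _ hx _ hz)
      (by
        simp only [Finset.forall_mem_map, Equiv.coe_toEmbedding, Equiv.symm_apply_apply]
        exact fun x hx z w hz hw => g.symm.injective (h3 x hx _ _ hz hw))
    simp only [Finset.forall_mem_map, Equiv.coe_toEmbedding, Equiv.symm_apply_apply] at hyD hyE hy
    refine ⟨g.symm y, ?_, ?_, ?_⟩
    · simpa only [hlt, g.apply_symm_apply] using hyD
    · simpa only [hlt, g.apply_symm_apply] using hyE
    · intro x hx z
      rw [hF, g.apply_symm_apply, hy x hx, g.symm_apply_apply]
  extend_X u s t G h1 h2 := by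
    obtain ⟨x, hxs, hxu, hx⟩ := hT.extend_X (σ u) (s.map f.toEmbedding) (t.map g.toEmbedding)
      (fun y z => G (g.symm y) (g.symm z))
      (by
        intro y hy z hz
        rw [Finset.mem_map_equiv] at hy ⊢
        simpa only [hlt, g.apply_symm_apply] using h1 _ hy _ hz)
      (by
        simp only [Finset.forall_mem_map, Equiv.coe_toEmbedding, Equiv.symm_apply_apply]
        exact fun x hx z w hz hw => g.symm.injective (h2 x hx _ _ hz hw))
    simp only [Finset.forall_mem_map, Equiv.coe_toEmbedding, Equiv.symm_apply_apply] at hx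
    refine ⟨f.symm x, ?_, ?_, ?_⟩
    · rwa [Finset.mem_map_equiv] at hxs
    · rwa [hpr, f.apply_symm_apply]
    · intro y hy z
      rw [hF, f.apply_symm_apply, hx y hy, g.symm_apply_apply]
  infinite_U := by
    have := hT.infinite_U
    exact Infinite.of_injective σ.symm σ.symm.injective

/-! ### Independent families of functions. -/

section Independent

/-- Hausdorff's theorem: there are `2^κ` independent functions from `κ` to `κ`. -/
theorem exists_independent_functions (X I : Type u) [Infinite X] (hI : #I ≤ 2 ^ #X) :
    ∃ f : I → X → X, ∀ (s : Finset I) (v : I → X), ∃ x, ∀ i ∈ s, f i x = v i := by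
  classical
  obtain ⟨S⟩ : Nonempty (I ↪ Set X) := by
    rw [← Cardinal.le_def, Cardinal.mk_set]
    exact hI
  obtain ⟨e⟩ : Nonempty (X ≃ Finset X × Finset (Finset X × X)) := by
    rw [← Cardinal.eq, Cardinal.mk_prod, Cardinal.lift_id, Cardinal.lift_id,
      Cardinal.mk_finset_of_infinite, Cardinal.mk_finset_of_infinite, Cardinal.mk_prod,
      Cardinal.lift_id, Cardinal.lift_id, Cardinal.mk_finset_of_infinite]
    simp
  -- A point codes a finite set A and a finite table h indexed by subsets of A. The function with
  -- index i looks up the trace of `S i` on A in this table.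
  let f : I → X → X := fun i x => Classical.epsilon fun k =>
    ((e x).1.filter (· ∈ S i), k) ∈ (e x).2
  refine ⟨f, fun s v => ?_⟩
  have hsep : ∀ i j, ∃ d, i ≠ j → ¬ (d ∈ S i ↔ d ∈ S j) := by
    intro i j
    by_cases hij : i = j
    · exact ⟨Classical.arbitrary X, fun h => (h hij).elim⟩
    · have : ¬ ∀ d, d ∈ S i ↔ d ∈ S j := fun h => hij (S.injective (Set.ext h))
      obtain ⟨d, hd⟩ := not_forall.1 this
      exact ⟨d, fun _ => hd⟩
  choose d hd using hsep
  -- `A` separates the sets `S i` for i in `s`, so their traces on it are distinct and the table is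
  -- unambiguous.
  let A : Finset X := (s ×ˢ s).image fun p => d p.1 p.2
  let h : Finset (Finset X × X) := s.image fun i => (A.filter (· ∈ S i), v i)
  refine ⟨e.symm (A, h), fun i hi => ?_⟩
  have hex : ∃ k, (A.filter (· ∈ S i), k) ∈ h := ⟨v i, Finset.mem_image_of_mem _ hi⟩
  have hspec := Classical.epsilon_spec hex
  have hf : f i (e.symm (A, h)) = Classical.epsilon fun k => (A.filter (· ∈ S i), k) ∈ h := by
    simp only [f, Equiv.apply_symm_apply]
  rw [← hf] at hspec
  obtain ⟨j, hj, hji⟩ := Finset.mem_image.1 hspec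
  rw [Prod.mk.injEq] at hji
  have : j = i := by
    by_contra hne
    have hdA : d j i ∈ A := Finset.mem_image.2 ⟨(j, i), Finset.mem_product.2 ⟨hj, hi⟩, rfl⟩
    have := Finset.ext_iff.1 hji.1 (d j i)
    simp only [Finset.mem_filter, hdA, true_and] at this
    exact hd j i hne this
  rw [← hji.2, this]

end Independent

/-! ### The dense order: blocks of words. -/

section ListOrder

variable {K : Type u} [LinearOrder K]

/-- A word lies below its proper extensions, so appending n + 2 copies of `c` to `s` suffices. -/
theorem List.exists_gt_getLast? (s : List K) (c : K) (n : ℕ) :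
    ∃ z, s < z ∧ z.getLast? = some c ∧ n < z.length := by
  induction s with
  | nil =>
    refine ⟨List.replicate (n + 1) c ++ [c], ?_, by simp, by simp⟩
    rw [List.replicate_succ, List.cons_append]
    exact List.nil_lt_cons _ _
  | cons a s ih =>
    obtain ⟨z, h1, h2, h3⟩ := ih
    refine ⟨a :: z, List.cons_lt_cons_iff.2 (Or.inr ⟨rfl, h1⟩), ?_, ?_⟩
    · rw [List.getLast?_cons, h2, Option.getD_some]
    · rw [List.length_cons]
      omega

/-- If `s` is a prefix of `t`, the witness continues `s` with a letter below the next letter of `t`;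
this is where a least letter would be fatal. Otherwise any extension of `s` stays below `t`. -/
theorem List.exists_between_getLast? [NoMinOrder K] {s t : List K} (h : s < t) (c : K) (n : ℕ) :
    ∃ z, s < z ∧ z < t ∧ z.getLast? = some c ∧ n < z.length := by
  induction s generalizing t with
  | nil =>
    match t, h with
    | a :: t, _ =>
      obtain ⟨b, hb⟩ := exists_lt a
      refine ⟨List.replicate (n + 1) b ++ [c], ?_, ?_, by simp, by simp⟩
      · rw [List.replicate_succ, List.cons_append]
        exact List.nil_lt_cons _ _
      · rw [List.replicate_succ, List.cons_append]
        exact List.cons_lt_cons_iff.2 (Or.inl hb)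
  | cons a s ih =>
    match t, h with
    | b :: t, h =>
      rcases List.cons_lt_cons_iff.1 h with hab | ⟨rfl, hst⟩
      · obtain ⟨z, h1, h2, h3⟩ := List.exists_gt_getLast? s c n
        refine ⟨a :: z, List.cons_lt_cons_iff.2 (Or.inr ⟨rfl, h1⟩),
          List.cons_lt_cons_iff.2 (Or.inl hab), ?_, ?_⟩
        · rw [List.getLast?_cons, h2, Option.getD_some]
        · rw [List.length_cons]
          omega
      · obtain ⟨z, h1, h2, h3, h4⟩ := ih hst
        refine ⟨a :: z, List.cons_lt_cons_iff.2 (Or.inr ⟨rfl, h1⟩),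
          List.cons_lt_cons_iff.2 (Or.inr ⟨rfl, h2⟩), ?_, ?_⟩
        · rw [List.getLast?_cons, h3, Option.getD_some]
        · rw [List.length_cons]
          omega

end ListOrder

/-- Blocks of non-empty lists of labels, arranged along `I`. -/
abbrev LabelledOrder (I K : Type u) : Type u := I ×ₗ {l : List K // l ≠ []}

namespace LabelledOrder

variable {I K : Type u}

def block (y : LabelledOrder I K) : I := (ofLex y).1

def word (y : LabelledOrder I K) : List K := (ofLex y).2

def label (y : LabelledOrder I K) : K := y.word.getLast (ofLex y).2.2

theorem lt_iff [LinearOrder I] [LinearOrder K] (y z : LabelledOrder I K) :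
    y < z ↔ y.block < z.block ∨ y.block = z.block ∧ y.word < z.word := Prod.Lex.lt_iff

theorem exists_mk (i : I) (l : List K) (c : K) (h : l.getLast? = some c) :
    ∃ y : LabelledOrder I K, y.block = i ∧ y.word = l ∧ y.label = c := by
  have hl : l ≠ [] := by
    rintro rfl
    simp at h
  refine ⟨toLex (i, ⟨l, hl⟩), rfl, rfl, ?_⟩
  rw [List.getLast?_eq_some_getLast hl] at h
  exact Option.some.inj h

variable [LinearOrder I] [LinearOrder K] [NoMinOrder K]

/-- Every cut between finite sets is filled, within a single block, by elements with arbitrary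
labels and arbitrarily long words. -/
theorem exists_between [Nonempty I] (D E : Finset (LabelledOrder I K))
    (h : ∀ d ∈ D, ∀ e ∈ E, d < e) :
    ∃ i : I, (∀ d ∈ D, d.block ≤ i) ∧ ∀ (c : K) (n : ℕ), ∃ z : LabelledOrder I K,
      z.block = i ∧ z.label = c ∧ n < z.word.length ∧ (∀ d ∈ D, d < z) ∧ ∀ e ∈ E, z < e := by
  have hle : ∀ y z : LabelledOrder I K, y ≤ z → y.block ≤ z.block := by
    intro y z hyz
    rcases hyz.lt_or_eq with h | rfl
    · rcases (lt_iff _ _).1 h with h | h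
      exacts [h.le, h.1.le]
    · rfl
  -- The new point goes just above the maximum of `D`. If `D` is empty, the empty word serves as
  -- lower bound: it is no point of the order and lies below every word of the block.
  obtain ⟨i, s, hD, hE⟩ : ∃ (i : I) (s : List K), (∀ d ∈ D, d.block < i ∨ d.block = i ∧ d.word ≤ s) ∧
      (∀ e ∈ E, i < e.block ∨ i = e.block ∧ s < e.word) := by
    rcases D.eq_empty_or_nonempty with rfl | hDne
    · rcases E.eq_empty_or_nonempty with rfl | hEne
      · exact ⟨Classical.arbitrary I, [], by simp, by simp⟩
      · refine ⟨(E.min' hEne).block, [], by simp, fun e he => ?_⟩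
        rcases (hle _ _ (E.min'_le e he)).lt_or_eq with h | h
        · exact Or.inl h
        · refine Or.inr ⟨h, ?_⟩
          obtain ⟨a, l, hl⟩ := List.exists_cons_of_ne_nil (ofLex e).2.2
          have : e.word = a :: l := hl
          rw [this]
          exact List.nil_lt_cons _ _
    · refine ⟨(D.max' hDne).block, (D.max' hDne).word, fun d hd => ?_, fun e he => ?_⟩
      · rcases (D.le_max' d hd).lt_or_eq with h | h
        · rcases (lt_iff _ _).1 h with h | h
          exacts [Or.inl h, Or.inr ⟨h.1, h.2.le⟩]
        · rw [← h]
          exact Or.inr ⟨rfl, le_rfl⟩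
      · exact (lt_iff _ _).1 (h _ (D.max'_mem hDne) e he)
  refine ⟨i, fun d hd => ?_, fun c n => ?_⟩
  · rcases hD d hd with h | h
    exacts [h.le, h.1.le]
  · obtain ⟨l, hsl, hlE, hlc, hln⟩ : ∃ l : List K, s < l ∧
        (∀ e ∈ E, i = e.block → l < e.word) ∧ l.getLast? = some c ∧ n < l.length := by
      classical
      by_cases hE' : (E.filter fun e => i = e.block).Nonempty
      · obtain ⟨e, he, hmin⟩ := Finset.exists_min_image _ word hE'
        rw [Finset.mem_filter] at he
        have hse : s < e.word := by
          rcases hE e he.1 with h | h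
          · exact absurd he.2 h.ne
          · exact h.2
        obtain ⟨l, h1, h2, h3⟩ := List.exists_between_getLast? hse c n
        exact ⟨l, h1, fun e' he' hi => h2.trans_le (hmin e' (Finset.mem_filter.2 ⟨he', hi⟩)), h3⟩
      · obtain ⟨l, h1, h3⟩ := List.exists_gt_getLast? s c n
        exact ⟨l, h1, fun e he hi => (hE' ⟨e, Finset.mem_filter.2 ⟨he, hi⟩⟩).elim, h3⟩
    obtain ⟨z, hzi, hzl, hzc⟩ := exists_mk i l c hlc
    refine ⟨z, hzi, hzc, hzl ▸ hln, fun d hd => ?_, fun e he => ?_⟩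
    · rw [lt_iff, hzi, hzl]
      rcases hD d hd with h | h
      · exact Or.inl h
      · exact Or.inr ⟨h.1, h.2.trans_lt hsl⟩
    · rw [lt_iff, hzi, hzl]
      rcases hE e he with h | h
      · exact Or.inl h
      · exact Or.inr ⟨h.1, hlE e he h.1⟩

end LabelledOrder

/-! ### A tower of size κ⁺ over a set of size κ. -/

/-- The bookkeeping for a tower. The labels in the block `i` code finite partial functions from
`X` to the elements up to block `i`. To every block, each `x` in `X` assigns a task: a finite
partial function on the elements up to this block. The tasks are independent. -/
structure TowerCode (X U I K : Type u) [LinearOrder I] where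
  dom : I → K → Finset X
  val : I → K → Finset (X × LabelledOrder I K)
  task : I → X → Finset (LabelledOrder I K × LabelledOrder I K)
  proj : X → U
  exists_label : ∀ (i : I) (s : Finset X) (G : Finset (X × LabelledOrder I K)),
    (∀ p ∈ G, p.2.block ≤ i) → ∃ c, dom i c = s ∧ val i c = G
  exists_task : ∀ (s : Finset I) (v : I → Finset (LabelledOrder I K × LabelledOrder I K)) (u : U)
    (s' : Finset X), (∀ i ∈ s, ∀ p ∈ v i, p.1.block ≤ i ∧ p.2.block ≤ i) →
    ∃ x, x ∉ s' ∧ proj x = u ∧ ∀ i ∈ s, task i x = v i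

namespace TowerCode

variable {X U I K : Type u} [LinearOrder I] [LinearOrder K] (C : TowerCode X U I K)

/-- The dense order on Y is not well-founded. When the blocks are well-ordered this relation is, and
all values prescribed by labels descend along it. -/
def Lower (w z : LabelledOrder I K) : Prop :=
  w.block < z.block ∨ w.block = z.block ∧ w.word.length < z.word.length

/-- If the label of `z` controls `x` then it determines the value at `z`, otherwise the task
of `x` does. -/
def F (z : LabelledOrder I K) (x : X) (w : LabelledOrder I K) : Prop :=
  w < z ∧
  ((x ∈ C.dom z.block z.label ∧ (x, w) ∈ C.val z.block z.label ∧ Lower w z ∧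
      ∀ w', (x, w') ∈ C.val z.block z.label → w' = w) ∨
    (x ∉ C.dom z.block z.label ∧ (z, w) ∈ C.task z.block x ∧
      ∀ w', (z, w') ∈ C.task z.block x → w' = w))

theorem F_unique {z : LabelledOrder I K} {x : X} {w w' : LabelledOrder I K} (h : C.F z x w)
    (h' : C.F z x w') : w = w' := by
  rcases h.2 with ⟨h1, h2, -, h3⟩ | ⟨h1, h2, h3⟩ <;>
  rcases h'.2 with ⟨h1', h2', -, h3'⟩ | ⟨h1', h2', h3'⟩
  · exact h3' _ h2
  · exact absurd h1 h1'
  · exact absurd h1' h1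
  · exact h3' _ h2

theorem block_le {y z : LabelledOrder I K} (h : y < z) : y.block ≤ z.block := by
  rcases (LabelledOrder.lt_iff _ _).1 h with h | h
  exacts [h.le, h.1.le]

/-- Values from labels descend in `Lower`, so recursion on word length handles them inside block `i`
and `ih` handles lower blocks. Task values at points of block `i` need not have shorter words; they
are left as the only permitted way out. -/
theorem exists_closed_step (s : Finset X) (i : I)
    (ih : ∀ y : LabelledOrder I K, y.block < i → ∃ t : Finset (LabelledOrder I K), y ∈ t ∧
      ∀ y' ∈ t, ∀ x ∈ s, ∀ z, C.F y' x z → z ∈ t)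
    (n : ℕ) : ∀ y : LabelledOrder I K, y.block ≤ i → (y.block = i → y.word.length = n) →
      ∃ t : Finset (LabelledOrder I K), y ∈ t ∧
        ∀ y' ∈ t, ∀ x ∈ s, ∀ z, C.F y' x z →
          z ∈ t ∨ ((y', z) ∈ C.task i x ∧ z.block ≤ i) := by
  classical
  induction n using Nat.strong_induction_on with
  | _ n ihn =>
    intro y hyi hyn
    rcases hyi.lt_or_eq with hlt | heq
    · obtain ⟨t, hyt, ht⟩ := ih y hlt
      exact ⟨t, hyt, fun y' hy' x hx z hz => Or.inl (ht y' hy' x hx z hz)⟩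
    have hfin : {v | ∃ x ∈ s, C.F y x v ∧ Lower v y}.Finite := by
      have : {v | ∃ x ∈ s, C.F y x v ∧ Lower v y} ⊆ ⋃ x ∈ s, {v | C.F y x v} := by
        rintro v ⟨x, hx, hv, -⟩
        exact Set.mem_biUnion (x := x) hx hv
      refine (Set.Finite.biUnion s.finite_toSet fun x _ => ?_).subset this
      exact Set.Subsingleton.finite fun a ha b hb => C.F_unique ha hb
    have hex : ∀ v, ∃ t : Finset (LabelledOrder I K), Lower v y → v ∈ t ∧
        ∀ y' ∈ t, ∀ x ∈ s, ∀ z, C.F y' x z →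
          z ∈ t ∨ ((y', z) ∈ C.task i x ∧ z.block ≤ i) := by
      intro v
      by_cases hv : Lower v y
      · rcases hv with hv | ⟨hv, hlen⟩
        · obtain ⟨t, h1, h2⟩ := ih v (heq ▸ hv)
          exact ⟨t, fun _ => ⟨h1, fun y' hy' x hx z hz => Or.inl (h2 y' hy' x hx z hz)⟩⟩
        · obtain ⟨t, ht⟩ := ihn v.word.length (hyn heq ▸ hlen) v (hv.trans heq).le fun _ => rfl
          exact ⟨t, fun _ => ht⟩
      · exact ⟨∅, fun h => (hv h).elim⟩
    choose t ht using hex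
    refine ⟨insert y (hfin.toFinset.biUnion t), Finset.mem_insert_self _ _, ?_⟩
    intro y' hy' x hx z hz
    rcases Finset.mem_insert.1 hy' with rfl | hy'
    · rcases hz.2 with ⟨-, -, hlow, -⟩ | ⟨-, h2, -⟩
      · refine Or.inl (Finset.mem_insert_of_mem (Finset.mem_biUnion.2 ⟨z, ?_, (ht z hlow).1⟩))
        rw [Set.Finite.mem_toFinset]
        exact ⟨x, hx, hz, hlow⟩
      · rw [heq] at h2
        exact Or.inr ⟨h2, (block_le hz.1).trans heq.le⟩
    · obtain ⟨v, hv, hy'v⟩ := Finset.mem_biUnion.1 hy'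
      have hv' := hv
      rw [Set.Finite.mem_toFinset] at hv'
      obtain ⟨-, -, -, hlow⟩ := hv'
      rcases (ht v hlow).2 y' hy'v x hx z hz with h | h
      · exact Or.inl (Finset.mem_insert_of_mem (Finset.mem_biUnion.2 ⟨v, hv, h⟩))
      · exact Or.inr h

theorem exists_closed [WellFoundedLT I] (s : Finset X) (i : I) :
    ∀ y : LabelledOrder I K, y.block = i → ∃ t : Finset (LabelledOrder I K), y ∈ t ∧
      ∀ y' ∈ t, ∀ x ∈ s, ∀ z, C.F y' x z → z ∈ t := by
  classical
  induction i using WellFoundedLT.induction with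
  | _ i ih =>
    intro y hy
    have hex : ∀ y : LabelledOrder I K, ∃ t : Finset (LabelledOrder I K), y.block ≤ i → y ∈ t ∧
        ∀ y' ∈ t, ∀ x ∈ s, ∀ z, C.F y' x z →
          z ∈ t ∨ ((y', z) ∈ C.task i x ∧ z.block ≤ i) := by
      intro y
      by_cases hy : y.block ≤ i
      · obtain ⟨t, ht⟩ := C.exists_closed_step s i (fun z hz => ih z.block hz z rfl) _ y hy
          fun _ => rfl
        exact ⟨t, fun _ => ht⟩
      · exact ⟨∅, fun h => (hy h).elim⟩
    choose t ht using hex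
    -- All remaining exits from block `i` are second coordinates of the finitely many finite tasks
    -- `task i x` with x in `s`. This list does not depend on the starting point, so adding the
    -- partial closures of its members once closes everything.
    let W : Finset (LabelledOrder I K) :=
      insert y ((s.biUnion fun x => (C.task i x).image Prod.snd).filter fun z => z.block ≤ i)
    have hW : ∀ w ∈ W, w.block ≤ i := by
      intro w hw
      rcases Finset.mem_insert.1 hw with rfl | hw
      · exact hy.le
      · exact (Finset.mem_filter.1 hw).2
    refine ⟨W.biUnion t, Finset.mem_biUnion.2 ⟨y, Finset.mem_insert_self _ _, (ht y hy.le).1⟩, ?_⟩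
    intro y' hy' x hx z hz
    obtain ⟨w, hw, hy'w⟩ := Finset.mem_biUnion.1 hy'
    rcases (ht w (hW w hw)).2 y' hy'w x hx z hz with h | ⟨h1, h2⟩
    · exact Finset.mem_biUnion.2 ⟨w, hw, h⟩
    · refine Finset.mem_biUnion.2 ⟨z, Finset.mem_insert_of_mem (Finset.mem_filter.2 ⟨?_, h2⟩),
        (ht z h2).1⟩
      exact Finset.mem_biUnion.2 ⟨x, hx, Finset.mem_image.2 ⟨(y', z), h1, rfl⟩⟩

theorem isTower [NoMinOrder K] [WellFoundedLT I] [Nonempty I] [Infinite U] :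
    IsTower (· < ·) (fun x u => C.proj x = u) C.F where
  irrefl := lt_irrefl
  trans _ _ _ := lt_trans
  total := lt_trichotomy
  pr_exists x := ⟨_, rfl⟩
  pr_unique _ _ _ h1 h2 := h1.symm.trans h2
  F_lt _ _ _ h := h.1
  F_unique _ _ _ _ h1 h2 := C.F_unique h1 h2
  locally_finite s y := C.exists_closed s _ y rfl
  extend_Y s D E G h1 h2 h3 := by
    classical
    obtain ⟨i, hDi, hi⟩ := LabelledOrder.exists_between D E h1
    -- The required values form a finite set of pairs over segments up to block `i`, hence are coded
    -- by a label of that block.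
    let V := (s ×ˢ D).filter fun p => G p.1 p.2
    have hV : ∀ x ∈ s, ∀ z, (x, z) ∈ V ↔ G x z := fun x hx z => by
      rw [Finset.mem_filter, Finset.mem_product]
      exact ⟨fun h => h.2, fun h => ⟨⟨hx, h2 x hx z h⟩, h⟩⟩
    obtain ⟨c, hc1, hc2⟩ := C.exists_label i s V fun p hp =>
      hDi _ (Finset.mem_product.1 (Finset.mem_filter.1 hp).1).2
    -- A word longer than all those in `D` puts the prescribed values in the same block strictly
    -- lower in `Lower`.
    obtain ⟨y, hyi, hyc, hyn, hyD, hyE⟩ := hi c (D.sup fun d => d.word.length)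
    refine ⟨y, hyD, hyE, fun x hx z => ?_⟩
    rw [F, hyi, hyc, hc1, hc2]
    constructor
    · rintro ⟨-, ⟨-, h, -⟩ | ⟨h, -⟩⟩
      · exact (hV x hx z).1 h
      · exact absurd hx h
    · intro hG
      have hzD := h2 x hx z hG
      refine ⟨hyD z hzD, Or.inl ⟨hx, (hV x hx z).2 hG, ?_, fun w hw =>
        h3 x hx _ _ ((hV x hx w).1 hw) hG⟩⟩
      rw [Lower, hyi]
      rcases (hDi z hzD).lt_or_eq with h | h
      · exact Or.inl h
      · exact Or.inr ⟨h, (Finset.le_sup (f := fun d => d.word.length) hzD).trans_lt hyn⟩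
  extend_X u s t G h1 h2 := by
    classical
    let v : I → Finset (LabelledOrder I K × LabelledOrder I K) := fun i =>
      (t ×ˢ t).filter fun p => p.1.block = i ∧ G p.1 p.2
    -- Besides `s`, the new x avoids the finitely many elements controlled by labels in `t`, so at
    -- every point of `t` its task decides the value.
    obtain ⟨x, hxs, hxu, hx⟩ := C.exists_task (t.image LabelledOrder.block) v u
      (s ∪ t.biUnion fun y => C.dom y.block y.label) (by
        intro i _ p hp
        obtain ⟨hp1, hp2, hp3⟩ := Finset.mem_filter.1 hp
        refine ⟨hp2.le, ?_⟩
        rw [← hp2]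
        exact block_le (h1 _ (Finset.mem_product.1 hp1).1 _ hp3).2)
    rw [Finset.mem_union, not_or, Finset.mem_biUnion] at hxs
    refine ⟨x, hxs.1, hxu, fun y hy z => ?_⟩
    have hdom : x ∉ C.dom y.block y.label := fun h => hxs.2 ⟨y, hy, h⟩
    have hv : ∀ z, (y, z) ∈ C.task y.block x ↔ G y z := by
      intro z
      rw [hx _ (Finset.mem_image_of_mem _ hy), Finset.mem_filter, Finset.mem_product]
      exact ⟨fun h => h.2.2, fun h => ⟨⟨hy, (h1 y hy z h).1⟩, rfl, h⟩⟩
    rw [F]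
    simp only [hv, hdom, false_and, false_or, not_false_eq_true, true_and]
    exact ⟨fun h => h.2.1, fun h => ⟨(h1 y hy z h).2, h, fun w hw => h2 y hy _ _ hw h⟩⟩
  infinite_U := inferInstance

end TowerCode

theorem exists_surjective_of_mk_le {A B : Type u} [Nonempty B] (h : #B ≤ #A) :
    ∃ f : A → B, Function.Surjective f := by
  obtain ⟨e⟩ := (Cardinal.le_def B A).1 h
  exact ⟨Function.invFun e, Function.invFun_surjective e.injective⟩

theorem mk_finset_le {A X : Type u} [Infinite X] (h : #A ≤ #X) : #(Finset A) ≤ #X := by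
  obtain ⟨e⟩ := (Cardinal.le_def A X).1 h
  rw [← Cardinal.mk_finset_of_infinite X]
  exact Cardinal.mk_le_of_injective (Finset.map_injective e)

theorem mk_prod_le {A B X : Type u} [Infinite X] (hA : #A ≤ #X) (hB : #B ≤ #X) :
    #(A × B) ≤ #X := by
  rw [Cardinal.mk_prod, Cardinal.lift_id, Cardinal.lift_id]
  exact Cardinal.mul_le_of_le (Cardinal.aleph0_le_mk X) hA hB

/-- Restricting codes to the segment up to a block keeps their number at most κ, so κ labels, or κ
values of a task function, can list them all. -/
theorem mk_segment_le {X I K : Type u} [Infinite X] [LinearOrder I] (hK : #K = #X)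
    (hI : ∀ i : I, #(Set.Iic i) ≤ #X) (i : I) :
    #{y : LabelledOrder I K // y.block ≤ i} ≤ #X := by
  have : Infinite K := by
    rw [Cardinal.infinite_iff, hK]
    exact Cardinal.aleph0_le_mk X
  have h1 : #{l : List K // l ≠ []} ≤ #X := by
    rw [← hK, ← Cardinal.mk_list_eq_mk K]
    exact Cardinal.mk_subtype_le _
  refine le_trans ?_ (mk_prod_le (hI i) h1)
  refine Cardinal.mk_le_of_injective
    (f := fun y => (⟨y.1.block, y.2⟩, (ofLex y.1).2)) ?_
  rintro ⟨y, hy⟩ ⟨z, hz⟩ h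
  rw [Prod.mk.injEq] at h
  exact Subtype.ext (Prod.ext (Subtype.ext_iff.1 h.1) h.2)

theorem exists_towerCode (X I K : Type u) [Infinite X] [LinearOrder I] (hK : #K = #X)
    (hI : ∀ i : I, #(Set.Iic i) ≤ #X) (hI' : #I ≤ Order.succ #X) :
    Nonempty (TowerCode X X I K) := by
  classical
  have hX := Cardinal.aleph0_le_mk X
  let S : I → Type u := fun i => {y : LabelledOrder I K // y.block ≤ i}
  have hS : ∀ i, #(S i) ≤ #X := mk_segment_le hK hI
  have hS₁ : ∀ i, #{p : X × LabelledOrder I K // p.2.block ≤ i} ≤ #X := fun i =>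
    (Cardinal.mk_le_of_injective (β := X × S i) (f := fun p => (p.1.1, ⟨p.1.2, p.2⟩))
      fun p q h => by
        rw [Prod.mk.injEq] at h
        exact Subtype.ext (Prod.ext h.1 (Subtype.ext_iff.1 h.2))).trans (mk_prod_le le_rfl (hS i))
  have hS₂ : ∀ i, #{p : LabelledOrder I K × LabelledOrder I K //
      p.1.block ≤ i ∧ p.2.block ≤ i} ≤ #X := fun i =>
    (Cardinal.mk_le_of_injective (β := S i × S i) (f := fun p => (⟨p.1.1, p.2.1⟩, ⟨p.1.2, p.2.2⟩))
      fun p q h => by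
        rw [Prod.mk.injEq] at h
        exact Subtype.ext (Prod.ext (Subtype.ext_iff.1 h.1) (Subtype.ext_iff.1 h.2))).trans
      (mk_prod_le (hS i) (hS i))
  have hlab : ∀ i, ∃ f : K → Finset X × Finset {p : X × LabelledOrder I K // p.2.block ≤ i},
      Function.Surjective f := fun i =>
    exists_surjective_of_mk_le (hK ▸ mk_prod_le (mk_finset_le le_rfl) (mk_finset_le (hS₁ i)))
  have htask : ∀ i, ∃ f : X → Finset {p : LabelledOrder I K × LabelledOrder I K //
      p.1.block ≤ i ∧ p.2.block ≤ i}, Function.Surjective f := fun i =>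
    exists_surjective_of_mk_le (mk_finset_le (hS₂ i))
  choose lab hlab using hlab
  choose tsk htsk using htask
  obtain ⟨g, hg⟩ := exists_surjective_of_mk_le (A := X) (B := X × X) (mk_prod_le le_rfl le_rfl)
  -- One independent function per block selects the task there; the extra index `none` supplies the
  -- projection. The family is this large because κ⁺ ≤ 2^κ.
  obtain ⟨f, hf⟩ := exists_independent_functions X (Option I) (by
    rw [Cardinal.mk_option]
    have h2 : #X < 2 ^ #X := Cardinal.cantor _
    refine Cardinal.add_le_of_le (hX.trans h2.le) (hI'.trans (Order.succ_le_of_lt h2)) ?_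
    exact Cardinal.one_le_aleph0.trans (hX.trans h2.le))
  refine ⟨{
    dom := fun i c => (lab i c).1
    val := fun i c => (lab i c).2.map (Function.Embedding.subtype _)
    task := fun i x => (tsk i (f (some i) x)).map (Function.Embedding.subtype _)
    proj := fun x => (g (f none x)).1
    exists_label := ?_
    exists_task := ?_ }⟩
  · intro i s G hG
    obtain ⟨c, hc⟩ := hlab i (s, G.subtype _)
    exact ⟨c, by rw [hc], by rw [hc, Finset.subtype_map_of_mem hG]⟩
  · intro s v u s' hv
    have hvc : ∀ i, ∃ k : X, i ∈ s → (tsk i k).map (Function.Embedding.subtype _) = v i := by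
      intro i
      by_cases hi : i ∈ s
      · obtain ⟨k, hk⟩ := htsk i ((v i).subtype _)
        exact ⟨k, fun _ => by rw [hk, Finset.subtype_map_of_mem (hv i hi)]⟩
      · exact ⟨Classical.arbitrary X, fun h => (hi h).elim⟩
    choose k hk using hvc
    -- The dummy second coordinate `n` yields infinitely many solutions, so some solution avoids
    -- `s'`.
    have hx : ∀ n : X, ∃ x, g (f none x) = (u, n) ∧
        ∀ i ∈ s, (tsk i (f (some i) x)).map (Function.Embedding.subtype _) = v i := by
      intro n
      obtain ⟨m, hm⟩ := hg (u, n)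
      obtain ⟨x, hx⟩ := hf (Finset.insertNone s) fun o => o.elim m k
      refine ⟨x, ?_, fun i hi => ?_⟩
      · rw [hx none (by simp)]
        exact hm
      · rw [hx (some i) (by simpa using hi)]
        exact hk i hi
    choose x hx1 hx2 using hx
    have hinj : Function.Injective x := by
      intro m n h
      have := hx1 m
      rw [h, hx1 n] at this
      exact (Prod.mk.inj this).2.symm
    obtain ⟨n, hn⟩ := Set.Infinite.exists_notMem_finset
      (Set.infinite_range_of_injective hinj) s'
    obtain ⟨⟨n, rfl⟩, hn⟩ := hn
    exact ⟨x n, hn, by rw [hx1], hx2 n⟩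

theorem exists_tower (X : Type u) [Infinite X] :
    ∃ (Y U : Type u) (lt : Y → Y → Prop) (pr : X → U → Prop) (F : Y → X → Y → Prop),
      IsTower lt pr F ∧ #Y = Order.succ #X ∧ #U = #X := by
  have hX := Cardinal.aleph0_le_mk X
  let I := (Order.succ #X).ord.ToType
  -- Reversing an infinite initial ordinal gives an alphabet of size κ without least letter.
  let K := (#X).ord.ToTypeᵒᵈ
  have hK : #K = #X := Cardinal.mk_ord_toType _
  have hI : #I = Order.succ #X := Cardinal.mk_ord_toType _
  have : NoMaxOrder (#X).ord.ToType := Cardinal.noMaxOrder hX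
  have hIic : ∀ i : I, #(Set.Iic i) ≤ #X := by
    intro i
    have h1 : #(Set.Iio i) ≤ #X := by
      have := Cardinal.mk_Iio_lt i (by rw [hI, Ordinal.type_toType])
      rwa [hI, Order.lt_succ_iff] at this
    have h2 : (Set.Iic i) = insert i (Set.Iio i) := by
      ext j
      simp [le_iff_eq_or_lt]
    rw [h2]
    exact Cardinal.mk_insert_le.trans
      (Cardinal.add_le_of_le hX h1 (Cardinal.one_le_aleph0.trans hX))
  obtain ⟨C⟩ := exists_towerCode X I K hK hIic hI.le
  have : Nonempty I := by
    rw [← Cardinal.mk_ne_zero_iff, hI]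
    exact (Order.bot_lt_succ #X).ne'
  have : Infinite K := by
    rw [Cardinal.infinite_iff, hK]
    exact hX
  refine ⟨LabelledOrder I K, X, _, _, _, C.isTower, le_antisymm ?_ ?_, rfl⟩
  · exact hI ▸ C.isTower.mk_Y_le
  · rw [← hI]
    obtain ⟨k⟩ : Nonempty K := inferInstance
    refine Cardinal.mk_le_of_injective (f := fun i : I => (toLex (i, ⟨[k], by simp⟩) :
      LabelledOrder I K)) fun i j h => ?_
    exact congrArg LabelledOrder.block h

/-! ### Expressing the tower axioms in the logic. -/

/-- The semantic condition `Q` is expressed by a formula of `L_{ω₁,ω}`. -/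
def InfDefinable (L : FirstOrder.Language.{0, 0}) {n : ℕ}
    (Q : ∀ (M : Type u) [L.Structure M], (Fin n → M) → Prop) : Prop :=
  ∃ φ : InfFormula L n, ∀ (M : Type u) [L.Structure M] (v : Fin n → M), φ.Realize M v ↔ Q M v

namespace InfDefinable

variable {L : FirstOrder.Language.{0, 0}} {n : ℕ}
  {Q R : ∀ (M : Type u) [L.Structure M], (Fin n → M) → Prop}

theorem congr (h : InfDefinable.{u} L Q)
    (hQR : ∀ (M : Type u) [L.Structure M] (v : Fin n → M), Q M v ↔ R M v) :
    InfDefinable.{u} L R := by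
  obtain ⟨φ, hφ⟩ := h
  exact ⟨φ, fun M _ v => (hφ M v).trans (hQR M v)⟩

theorem const (p : Prop) : InfDefinable.{u} L (n := n) fun _ _ _ => p := by
  by_cases hp : p
  · exact ⟨.imp .falsum .falsum, fun M _ v => iff_of_true id hp⟩
  · exact ⟨.falsum, fun M _ v => iff_of_false id hp⟩

theorem imp (hQ : InfDefinable.{u} L Q) (hR : InfDefinable.{u} L R) :
    InfDefinable.{u} L fun M _ v => Q M v → R M v := by
  obtain ⟨φ, hφ⟩ := hQ
  obtain ⟨ψ, hψ⟩ := hR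
  exact ⟨.imp φ ψ, fun M _ v => imp_congr (hφ M v) (hψ M v)⟩

theorem not (hQ : InfDefinable.{u} L Q) : InfDefinable.{u} L fun M _ v => ¬ Q M v :=
  hQ.imp (const False)

theorem or (hQ : InfDefinable.{u} L Q) (hR : InfDefinable.{u} L R) :
    InfDefinable.{u} L fun M _ v => Q M v ∨ R M v :=
  (hQ.not.imp hR).congr fun _ _ _ => or_iff_not_imp_left.symm

theorem and (hQ : InfDefinable.{u} L Q) (hR : InfDefinable.{u} L R) :
    InfDefinable.{u} L fun M _ v => Q M v ∧ R M v :=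
  (hQ.imp hR.not).not.congr fun _ _ _ => by rw [Classical.not_imp, not_not]

theorem iff (hQ : InfDefinable.{u} L Q) (hR : InfDefinable.{u} L R) :
    InfDefinable.{u} L fun M _ v => Q M v ↔ R M v :=
  ((hQ.imp hR).and (hR.imp hQ)).congr fun _ _ _ => iff_iff_implies_and_implies.symm

theorem forall_countable {ι : Type*} [Countable ι]
    {Q : ι → ∀ (M : Type u) [L.Structure M], (Fin n → M) → Prop}
    (h : ∀ i, InfDefinable.{u} L (Q i)) : InfDefinable.{u} L fun M _ v => ∀ i, Q i M v := by
  choose φ hφ using h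
  rcases isEmpty_or_nonempty ι with hι | hι
  · exact (const True).congr fun M _ v => by simp
  · obtain ⟨f, hf⟩ := exists_surjective_nat ι
    refine ⟨.conj fun i => φ (f i), fun M _ v => ?_⟩
    exact (forall_congr' fun i => hφ (f i) M v).trans (hf.forall (p := fun i => Q i M v)).symm

theorem exists_countable {ι : Type*} [Countable ι]
    {Q : ι → ∀ (M : Type u) [L.Structure M], (Fin n → M) → Prop}
    (h : ∀ i, InfDefinable.{u} L (Q i)) : InfDefinable.{u} L fun M _ v => ∃ i, Q i M v :=
  (forall_countable fun i => (h i).not).not.congr fun _ _ _ => by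
    rw [not_forall_not]

theorem all {Q : ∀ (M : Type u) [L.Structure M], (Fin n → M) → M → Prop}
    (h : InfDefinable.{u} L (n := n + 1) fun M _ v => Q M (fun i => v i.castSucc) (v (Fin.last n))) :
    InfDefinable.{u} L fun M _ v => ∀ a, Q M v a := by
  obtain ⟨φ, hφ⟩ := h
  refine ⟨.all φ, fun _ _ _ => forall_congr' fun a => ?_⟩
  rw [hφ]
  simp only [Fin.snoc_castSucc, Fin.snoc_last]

theorem ex {Q : ∀ (M : Type u) [L.Structure M], (Fin n → M) → M → Prop}
    (h : InfDefinable.{u} L (n := n + 1) fun M _ v => Q M (fun i => v i.castSucc) (v (Fin.last n))) :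
    InfDefinable.{u} L fun M _ v => ∃ a, Q M v a :=
  (all (Q := fun M _ v a => ¬ Q M v a) h.not).not.congr fun _ _ _ => by
    rw [not_forall_not]

theorem allTuple {k : ℕ} {Q : ∀ (M : Type u) [L.Structure M], (Fin n → M) → (Fin k → M) → Prop}
    (h : InfDefinable.{u} L (n := n + k) fun M _ v =>
      Q M (fun i => v (i.castAdd k)) fun j => v (j.natAdd n)) :
    InfDefinable.{u} L fun M _ v => ∀ w, Q M v w := by
  induction k with
  | zero =>
    exact h.congr fun M _ v =>
      ⟨fun hv w => by rwa [Subsingleton.elim w], fun hv => hv _⟩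
  | succ k ih =>
    refine (ih (Q := fun M _ v w => ∀ a : M, Q M v (Fin.snoc w a)) (all ?_)).congr
      fun M _ v => ?_
    · refine h.congr fun M _ v => iff_of_eq ?_
      congr 1
      ext j
      refine Fin.lastCases ?_ (fun j => ?_) j
      · rw [Fin.snoc_last]
        rfl
      · rw [Fin.snoc_castSucc]
        rfl
    · refine ⟨fun hv w => ?_, fun hv w a => hv _⟩
      have := hv (Fin.init w) (w (Fin.last k))
      rwa [Fin.snoc_init_self] at this

theorem exTuple {k : ℕ} {Q : ∀ (M : Type u) [L.Structure M], (Fin n → M) → (Fin k → M) → Prop}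
    (h : InfDefinable.{u} L (n := n + k) fun M _ v =>
      Q M (fun i => v (i.castAdd k)) fun j => v (j.natAdd n)) :
    InfDefinable.{u} L fun M _ v => ∃ w, Q M v w :=
  (allTuple (Q := fun M _ v w => ¬ Q M v w) h.not).not.congr fun _ _ _ => by
    rw [not_forall_not]

theorem eq (i j : Fin n) : InfDefinable.{u} L fun _ _ v => v i = v j :=
  ⟨.equal (.var i) (.var j), fun _ _ _ => Iff.rfl⟩

theorem rel {k : ℕ} (R : L.Relations k) (r : Fin k → Fin n) :
    InfDefinable.{u} L fun _ _ v => FirstOrder.Language.Structure.RelMap R fun i => v (r i) :=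
  ⟨.rel R fun i => .var (r i), fun _ _ _ => Iff.rfl⟩

theorem mem_predSet (R : L.Relations 1) (i : Fin n) :
    InfDefinable.{u} L fun M _ v => v i ∈ predSet M R :=
  (rel R ![i]).congr fun _ _ _ =>
    iff_of_eq (congrArg _ (funext fun j => by fin_cases j; rfl))

theorem binRel (R : L.Relations 2) (i j : Fin n) :
    InfDefinable.{u} L fun M _ v => binRel M R (v i) (v j) :=
  (rel R ![i, j]).congr fun _ _ _ =>
    iff_of_eq (congrArg _ (funext fun j => by fin_cases j <;> rfl))

theorem funMap_eq {k : ℕ} (f : L.Functions k) (r : Fin k → Fin n) (j : Fin n) :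
    InfDefinable.{u} L fun _ _ v =>
      FirstOrder.Language.Structure.funMap f (fun i => v (r i)) = v j :=
  ⟨.equal (.func f fun i => .var (r i)) (.var j), fun _ _ _ => Iff.rfl⟩

end InfDefinable

/-- The interpretation of a ternary predicate. -/
def terRel {L : FirstOrder.Language.{0, 0}} (M : Type u) [L.Structure M] (R : L.Relations 3)
    (a b c : M) : Prop :=
  FirstOrder.Language.Structure.RelMap R ![a, b, c]

theorem InfDefinable.terRel {L : FirstOrder.Language.{0, 0}} {n : ℕ} (R : L.Relations 3)
    (i j k : Fin n) : InfDefinable.{u} L fun M _ v => terRel M R (v i) (v j) (v k) :=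
  (InfDefinable.rel R ![i, j, k]).congr fun _ _ _ =>
    iff_of_eq (congrArg _ (funext fun j => by fin_cases j <;> rfl))

/-- Towers whose sorts are subsets of one set, axiomatized through finite tuples. -/
structure IsSortedTower {M : Type*} (X Y U : Set M) (lt pr : M → M → Prop)
    (F : M → M → M → Prop) : Prop where
  lt_mem : ∀ a b, lt a b → a ∈ Y ∧ b ∈ Y
  pr_mem : ∀ a b, pr a b → a ∈ X ∧ b ∈ U
  F_mem : ∀ a b c, F a b c → a ∈ Y ∧ b ∈ X ∧ c ∈ Y
  irrefl : ∀ a, ¬ lt a a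
  trans : ∀ a b c, lt a b → lt b c → lt a c
  total : ∀ a, a ∈ Y → ∀ b, b ∈ Y → lt a b ∨ a = b ∨ lt b a
  pr_exists : ∀ x, x ∈ X → ∃ u, pr x u
  pr_unique : ∀ x u v, pr x u → pr x v → u = v
  F_lt : ∀ y x z, F y x z → lt z y
  F_unique : ∀ y x z w, F y x z → F y x w → z = w
  locally_finite : ∀ (m : ℕ) (x : Fin m → M) (y : M), (∀ i, x i ∈ X) → y ∈ Y →
    ∃ (k : ℕ) (t : Fin k → M), (∀ i, t i ∈ Y) ∧ (∃ i, t i = y) ∧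
      ∀ i j z, F (t i) (x j) z → ∃ l, t l = z
  extend_Y : ∀ (m a b : ℕ) (G : Fin m → Fin a → Prop) (x : Fin m → M) (d : Fin a → M)
    (e : Fin b → M), (∀ i, x i ∈ X) → (∀ i, d i ∈ Y) → (∀ i, e i ∈ Y) →
    (∀ i j, x i = x j → i = j) → (∀ i j, lt (d i) (e j)) →
    (∀ i j k, G i j → G i k → d j = d k) →
    ∃ y, y ∈ Y ∧ (∀ i, lt (d i) y) ∧ (∀ i, lt y (e i)) ∧
      ∀ i z, F y (x i) z ↔ ∃ j, G i j ∧ d j = z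
  extend_X : ∀ (m a : ℕ) (G : Fin a → Fin a → Prop) (u : M) (x : Fin m → M) (t : Fin a → M),
    u ∈ U → (∀ i, x i ∈ X) → (∀ i, t i ∈ Y) → (∀ i j, t i = t j → i = j) →
    (∀ i j, G i j → lt (t j) (t i)) → (∀ i j k, G i j → G i k → t j = t k) →
    ∃ x', (∀ i, x i ≠ x') ∧ pr x' u ∧ ∀ i z, F (t i) x' z ↔ ∃ j, G i j ∧ t j = z
  infinite_U : ∀ (m : ℕ) (u : Fin m → M), ∃ v, v ∈ U ∧ ∀ i, u i ≠ v

-- Finite sets become tuples and a finite partial function becomes a pattern `G` on indices. Lengths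
-- and patterns live outside the structure and range over countable types, so quantifying over them
-- gives countable conjunctions and disjunctions.
open InfDefinable in
theorem infDefinable_isSortedTower {L : FirstOrder.Language.{0, 0}} (X Y U : L.Relations 1)
    (lt pr : L.Relations 2) (F : L.Relations 3) :
    InfDefinable.{u} L (n := 0) fun M _ _ => IsSortedTower (predSet M X) (predSet M Y)
      (predSet M U) (_root_.binRel M lt) (_root_.binRel M pr) (_root_.terRel M F) := by
  have h : InfDefinable.{u} L (n := 0) fun M _ _ =>
      (∀ a b, _root_.binRel M lt a b → a ∈ predSet M Y ∧ b ∈ predSet M Y) ∧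
      (∀ a b, _root_.binRel M pr a b → a ∈ predSet M X ∧ b ∈ predSet M U) ∧
      (∀ a b c, _root_.terRel M F a b c → a ∈ predSet M Y ∧ b ∈ predSet M X ∧ c ∈ predSet M Y) ∧
      (∀ a, ¬ _root_.binRel M lt a a) ∧
      (∀ a b c, _root_.binRel M lt a b → _root_.binRel M lt b c → _root_.binRel M lt a c) ∧
      (∀ a, a ∈ predSet M Y → ∀ b, b ∈ predSet M Y →
        _root_.binRel M lt a b ∨ a = b ∨ _root_.binRel M lt b a) ∧
      (∀ x, x ∈ predSet M X → ∃ u, _root_.binRel M pr x u) ∧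
      (∀ x u v, _root_.binRel M pr x u → _root_.binRel M pr x v → u = v) ∧
      (∀ y x z, _root_.terRel M F y x z → _root_.binRel M lt z y) ∧
      (∀ y x z w, _root_.terRel M F y x z → _root_.terRel M F y x w → z = w) ∧
      (∀ (m : ℕ) (x : Fin m → M) (y : M), (∀ i, x i ∈ predSet M X) → y ∈ predSet M Y →
        ∃ (k : ℕ) (t : Fin k → M), (∀ i, t i ∈ predSet M Y) ∧ (∃ i, t i = y) ∧
          ∀ i j z, _root_.terRel M F (t i) (x j) z → ∃ l, t l = z) ∧
      (∀ (m a b : ℕ) (G : Fin m → Fin a → Prop) (x : Fin m → M) (d : Fin a → M)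
        (e : Fin b → M), (∀ i, x i ∈ predSet M X) → (∀ i, d i ∈ predSet M Y) →
        (∀ i, e i ∈ predSet M Y) →
        (∀ i j, x i = x j → i = j) → (∀ i j, _root_.binRel M lt (d i) (e j)) →
        (∀ i j k, G i j → G i k → d j = d k) →
        ∃ y, y ∈ predSet M Y ∧ (∀ i, _root_.binRel M lt (d i) y) ∧
          (∀ i, _root_.binRel M lt y (e i)) ∧
          ∀ i z, _root_.terRel M F y (x i) z ↔ ∃ j, G i j ∧ d j = z) ∧
      (∀ (m a : ℕ) (G : Fin a → Fin a → Prop) (u : M) (x : Fin m → M) (t : Fin a → M),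
        u ∈ predSet M U → (∀ i, x i ∈ predSet M X) → (∀ i, t i ∈ predSet M Y) →
        (∀ i j, t i = t j → i = j) →
        (∀ i j, G i j → _root_.binRel M lt (t j) (t i)) →
        (∀ i j k, G i j → G i k → t j = t k) →
        ∃ x', (∀ i, x i ≠ x') ∧ _root_.binRel M pr x' u ∧
          ∀ i z, _root_.terRel M F (t i) x' z ↔ ∃ j, G i j ∧ t j = z) ∧
      (∀ (m : ℕ) (u : Fin m → M), ∃ v, v ∈ predSet M U ∧ ∀ i, u i ≠ v) := by
    repeat' first
      | exact mem_predSet _ _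
      | exact InfDefinable.binRel _ _ _
      | exact InfDefinable.terRel _ _ _ _
      | exact InfDefinable.eq _ _
      | exact InfDefinable.const _
      | apply InfDefinable.and
      | apply InfDefinable.or
      | apply InfDefinable.iff
      | apply InfDefinable.not
      | apply InfDefinable.all
      | apply InfDefinable.ex
      | apply InfDefinable.allTuple
      | apply InfDefinable.exTuple
      | apply InfDefinable.imp
      | (refine InfDefinable.forall_countable fun _ => ?_)
      | (refine InfDefinable.exists_countable fun _ => ?_)
  refine h.congr fun M _ _ => ⟨?_, ?_⟩
  · rintro ⟨h1, h2, h3, h4, h5, h6, h7, h8, h9, h10, h11, h12, h13, h14⟩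
    exact ⟨h1, h2, h3, h4, h5, h6, h7, h8, h9, h10, h11, h12, h13, h14⟩
  · rintro ⟨h1, h2, h3, h4, h5, h6, h7, h8, h9, h10, h11, h12, h13, h14⟩
    exact ⟨h1, h2, h3, h4, h5, h6, h7, h8, h9, h10, h11, h12, h13, h14⟩

theorem Finset.exists_enumeration {α : Type*} (s : Finset α) :
    ∃ (n : ℕ) (f : Fin n → α), Function.Injective f ∧ (∀ i, f i ∈ s) ∧ ∀ a ∈ s, ∃ i, f i = a :=
  ⟨s.card, fun i => s.equivFin.symm i, Subtype.val_injective.comp s.equivFin.symm.injective,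
    fun i => (s.equivFin.symm i).2, fun a ha => ⟨s.equivFin ⟨a, ha⟩, by simp⟩⟩

section SortedTower

variable {M : Type*} {X Y U : Set M} {lt pr : M → M → Prop} {F : M → M → M → Prop}

theorem IsSortedTower.isTower (h : IsSortedTower X Y U lt pr F) :
    IsTower (fun a b : Y => lt a b) (fun (x : X) (u : U) => pr x u)
      (fun (y : Y) (x : X) (z : Y) => F y x z) where
  irrefl a := h.irrefl a
  trans a b c := h.trans a b c
  total a b := by
    rw [Subtype.ext_iff]
    exact h.total a a.2 b b.2
  pr_exists x := by
    obtain ⟨u, hu⟩ := h.pr_exists x x.2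
    exact ⟨⟨u, (h.pr_mem _ _ hu).2⟩, hu⟩
  pr_unique x u v h1 h2 := Subtype.ext (h.pr_unique _ _ _ h1 h2)
  F_lt y x z := h.F_lt y x z
  F_unique y x z w h1 h2 := Subtype.ext (h.F_unique _ _ _ _ h1 h2)
  locally_finite s y := by
    classical
    obtain ⟨m, x, -, -, hx⟩ := s.exists_enumeration
    obtain ⟨k, t, htY, ⟨i, hi⟩, ht⟩ := h.locally_finite m (fun i => x i) y (fun i => (x i).2) y.2
    refine ⟨Finset.univ.image fun i => ⟨t i, htY i⟩, Finset.mem_image.2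
      ⟨i, Finset.mem_univ _, Subtype.ext hi⟩, ?_⟩
    intro y' hy' x' hx' z hz
    obtain ⟨i, -, rfl⟩ := Finset.mem_image.1 hy'
    obtain ⟨j, rfl⟩ := hx x' hx'
    obtain ⟨l, hl⟩ := ht i j z hz
    exact Finset.mem_image.2 ⟨l, Finset.mem_univ _, Subtype.ext hl⟩
  extend_Y s D E G h1 h2 h3 := by
    obtain ⟨m, x, hxi, hxs, hx⟩ := s.exists_enumeration
    obtain ⟨a, d, -, hdD, hd⟩ := D.exists_enumeration
    obtain ⟨b, e, -, heE, he⟩ := E.exists_enumeration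
    obtain ⟨y, hy, hyd, hye, hyF⟩ := h.extend_Y m a b (fun i j => G (x i) (d j))
      (fun i => x i) (fun i => d i) (fun i => e i) (fun i => (x i).2) (fun i => (d i).2)
      (fun i => (e i).2) (fun i j hij => hxi (Subtype.ext hij))
      (fun i j => h1 _ (hdD i) _ (heE j))
      (fun i j k hj hk => congrArg _ (h3 _ (hxs i) _ _ hj hk))
    refine ⟨⟨y, hy⟩, fun c hc => ?_, fun c hc => ?_, fun x' hx' z => ?_⟩
    · obtain ⟨i, rfl⟩ := hd c hc
      exact hyd i
    · obtain ⟨i, rfl⟩ := he c hc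
      exact hye i
    · obtain ⟨i, rfl⟩ := hx x' hx'
      refine (hyF i z).trans ⟨?_, fun hG => ?_⟩
      · rintro ⟨j, hj, hjz⟩
        rwa [← Subtype.ext hjz]
      · obtain ⟨j, rfl⟩ := hd z (h2 _ hx' _ hG)
        exact ⟨j, hG, rfl⟩
  extend_X u s t G h1 h2 := by
    obtain ⟨m, x, -, -, hx⟩ := s.exists_enumeration
    obtain ⟨a, d, hdi, hdt, hd⟩ := t.exists_enumeration
    obtain ⟨x', hx's, hx'u, hx'⟩ := h.extend_X m a (fun i j => G (d i) (d j)) u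
      (fun i => x i) (fun i => d i) u.2 (fun i => (x i).2) (fun i => (d i).2)
      (fun i j hij => hdi (Subtype.ext hij))
      (fun i j hij => (h1 _ (hdt i) _ hij).2)
      (fun i j k hj hk => congrArg _ (h2 _ (hdt i) _ _ hj hk))
    refine ⟨⟨x', (h.pr_mem _ _ hx'u).1⟩, fun hs => ?_, hx'u, fun y hy z => ?_⟩
    · obtain ⟨i, hi⟩ := hx _ hs
      exact hx's i (congrArg Subtype.val hi)
    · obtain ⟨i, rfl⟩ := hd y hy
      refine (hx' i z).trans ⟨?_, fun hG => ?_⟩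
      · rintro ⟨j, hj, hjz⟩
        rwa [← Subtype.ext hjz]
      · obtain ⟨j, rfl⟩ := hd z (h1 _ hy _ hG).1
        exact ⟨j, hG, rfl⟩
  infinite_U := by
    rw [Set.infinite_coe_iff]
    intro hfin
    obtain ⟨m, u, -, -, hu⟩ := hfin.toFinset.exists_enumeration
    obtain ⟨v, hv, hne⟩ := h.infinite_U m u
    obtain ⟨i, hi⟩ := hu v (hfin.mem_toFinset.2 hv)
    exact hne i hi

theorem IsTower.isSortedTower (hlt : ∀ a b, lt a b → a ∈ Y ∧ b ∈ Y)
    (hpr : ∀ a b, pr a b → a ∈ X ∧ b ∈ U) (hF : ∀ a b c, F a b c → a ∈ Y ∧ b ∈ X ∧ c ∈ Y)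
    (h : IsTower (fun a b : Y => lt a b) (fun (x : X) (u : U) => pr x u)
      (fun (y : Y) (x : X) (z : Y) => F y x z)) : IsSortedTower X Y U lt pr F where
  lt_mem := hlt
  pr_mem := hpr
  F_mem := hF
  irrefl a ha := h.irrefl ⟨a, (hlt a a ha).1⟩ ha
  trans a b c h1 h2 := h.trans ⟨a, (hlt _ _ h1).1⟩ ⟨b, (hlt _ _ h1).2⟩ ⟨c, (hlt _ _ h2).2⟩ h1 h2
  total a ha b hb := by
    have := h.total ⟨a, ha⟩ ⟨b, hb⟩
    rwa [Subtype.ext_iff] at this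
  pr_exists x hx := by
    obtain ⟨u, hu⟩ := h.pr_exists ⟨x, hx⟩
    exact ⟨u, hu⟩
  pr_unique x u v h1 h2 := congrArg Subtype.val
    (h.pr_unique ⟨x, (hpr _ _ h1).1⟩ ⟨u, (hpr _ _ h1).2⟩ ⟨v, (hpr _ _ h2).2⟩ h1 h2)
  F_lt y x z h1 := h.F_lt ⟨y, (hF _ _ _ h1).1⟩ ⟨x, (hF _ _ _ h1).2.1⟩ ⟨z, (hF _ _ _ h1).2.2⟩ h1
  F_unique y x z w h1 h2 := congrArg Subtype.val
    (h.F_unique ⟨y, (hF _ _ _ h1).1⟩ ⟨x, (hF _ _ _ h1).2.1⟩ ⟨z, (hF _ _ _ h1).2.2⟩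
      ⟨w, (hF _ _ _ h2).2.2⟩ h1 h2)
  locally_finite m x y hx hy := by
    classical
    obtain ⟨t, hyt, ht⟩ := h.locally_finite (Finset.univ.image fun i => ⟨x i, hx i⟩) ⟨y, hy⟩
    obtain ⟨k, f, -, hft, hf⟩ := t.exists_enumeration
    refine ⟨k, fun i => f i, fun i => (f i).2, ?_, fun i j z hz => ?_⟩
    · obtain ⟨i, hi⟩ := hf _ hyt
      exact ⟨i, congrArg Subtype.val hi⟩
    · obtain ⟨l, hl⟩ := hf _ (ht (f i) (hft i) ⟨x j, hx j⟩
        (Finset.mem_image_of_mem _ (Finset.mem_univ j)) ⟨z, (hF _ _ _ hz).2.2⟩ hz)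
      exact ⟨l, congrArg Subtype.val hl⟩
  extend_Y m a b G x d e hx hd he hxi hde hG := by
    classical
    obtain ⟨y, hyD, hyE, hyF⟩ := h.extend_Y (Finset.univ.image fun i => ⟨x i, hx i⟩)
      (Finset.univ.image fun i => ⟨d i, hd i⟩) (Finset.univ.image fun i => ⟨e i, he i⟩)
      (fun p q => ∃ i j, x i = p ∧ d j = q ∧ G i j)
      (by
        simp only [Finset.forall_mem_image]
        exact fun i _ j _ => hde i j)
      (by
        rintro p - q ⟨i, j, -, hq, -⟩
        exact Finset.mem_image.2 ⟨j, Finset.mem_univ _, Subtype.ext hq⟩)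
      (by
        rintro p - q r ⟨i, j, hi, hj, hij⟩ ⟨i', k, hi', hk, hik⟩
        obtain rfl := hxi _ _ (hi.trans hi'.symm)
        exact Subtype.ext (hj.symm.trans ((hG _ _ _ hij hik).trans hk)))
    simp only [Finset.forall_mem_image] at hyD hyE hyF
    refine ⟨y, y.2, fun i => hyD (Finset.mem_univ i), fun i => hyE (Finset.mem_univ i),
      fun i z => ⟨fun hz => ?_, ?_⟩⟩
    · obtain ⟨i', j, hi, hj, hij⟩ := (hyF (Finset.mem_univ i) ⟨z, (hF _ _ _ hz).2.2⟩).1 hz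
      obtain rfl := hxi _ _ hi
      exact ⟨j, hij, hj⟩
    · rintro ⟨j, hij, rfl⟩
      exact (hyF (Finset.mem_univ i) ⟨d j, hd j⟩).2 ⟨i, j, rfl, rfl, hij⟩
  extend_X m a G u x t hu hx ht hti hlt' hG := by
    classical
    obtain ⟨x', hx's, hx'u, hx'F⟩ := h.extend_X ⟨u, hu⟩ (Finset.univ.image fun i => ⟨x i, hx i⟩)
      (Finset.univ.image fun i => ⟨t i, ht i⟩) (fun p q => ∃ i j, t i = p ∧ t j = q ∧ G i j)
      (by
        rintro p - q ⟨i, j, hi, hj, hij⟩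
        refine ⟨Finset.mem_image.2 ⟨j, Finset.mem_univ _, Subtype.ext hj⟩, ?_⟩
        rw [← hi, ← hj]
        exact hlt' _ _ hij)
      (by
        rintro p - q r ⟨i, j, hi, hj, hij⟩ ⟨i', k, hi', hk, hik⟩
        obtain rfl := hti _ _ (hi.trans hi'.symm)
        exact Subtype.ext (hj.symm.trans ((hG _ _ _ hij hik).trans hk)))
    simp only [Finset.forall_mem_image] at hx'F
    refine ⟨x', fun i hi => hx's (Finset.mem_image.2 ⟨i, Finset.mem_univ _, Subtype.ext hi⟩),
      hx'u, fun i z => ⟨fun hz => ?_, ?_⟩⟩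
    · obtain ⟨i', j, hi, hj, hij⟩ := (hx'F (Finset.mem_univ i) ⟨z, (hF _ _ _ hz).2.2⟩).1 hz
      obtain rfl := hti _ _ hi
      exact ⟨j, hij, hj⟩
    · rintro ⟨j, hij, rfl⟩
      exact (hx'F (Finset.mem_univ i) ⟨t j, ht j⟩).2 ⟨i, j, rfl, rfl, hij⟩
  infinite_U m u := by
    classical
    obtain ⟨v, hvU, hv⟩ := (Set.infinite_coe_iff.1 h.infinite_U).exists_notMem_finset
      (Finset.univ.image u)
    exact ⟨v, hvU, fun i hi => hv (Finset.mem_image.2 ⟨i, Finset.mem_univ _, hi⟩)⟩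

end SortedTower

/-! ### The extended vocabulary and relativization. -/

/-- The symbols for the tower: the base sort, the ordered sort, the sort of indiscernibles,
the order, the projection and the regressive functions. -/
inductive TowerRel : ℕ → Type
  | base : TowerRel 1
  | ordered : TowerRel 1
  | indisc : TowerRel 1
  | lt : TowerRel 2
  | pr : TowerRel 2
  | F : TowerRel 3

/-- The vocabulary `L` together with the symbols for a tower. -/
abbrev towerExtension (L : FirstOrder.Language.{0, 0}) : FirstOrder.Language.{0, 0} :=
  L.sum ⟨fun _ => Empty, TowerRel⟩

section Vocabulary

variable {L : FirstOrder.Language.{0, 0}}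

def TowerRel.rel {n : ℕ} (R : TowerRel n) : (towerExtension L).Relations n := Sum.inr R

def baseRel {n : ℕ} (R : L.Relations n) : (towerExtension L).Relations n := Sum.inl R

def baseFun {n : ℕ} (f : L.Functions n) : (towerExtension L).Functions n := Sum.inl f

theorem countable_functions (L : FirstOrder.Language.{0, 0}) [Countable L.Symbols] (n : ℕ) :
    Countable (L.Functions n) :=
  (Sum.inl_injective.comp sigma_mk_injective :
    Function.Injective fun f : L.Functions n => (Sum.inl ⟨n, f⟩ : L.Symbols)).countable

theorem countable_relations (L : FirstOrder.Language.{0, 0}) [Countable L.Symbols] (n : ℕ) :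
    Countable (L.Relations n) :=
  (Sum.inr_injective.comp sigma_mk_injective :
    Function.Injective fun R : L.Relations n => (Sum.inr ⟨n, R⟩ : L.Symbols)).countable

theorem countable_towerExtension [Countable L.Symbols] : Countable (towerExtension L).Symbols := by
  have h3 := countable_functions L
  have h4 := countable_relations L
  have h5 : ∀ n, Countable (TowerRel n) := by
    intro n
    refine Function.Injective.countable (f := fun R : TowerRel n => (match R with
      | .base => 0 | .ordered => 1 | .indisc => 2 | .lt => 3 | .pr => 4 | .F => 5 : ℕ)) ?_
    intro a b h
    cases a <;> cases b <;> first | rfl | (simp at h)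
  have h6 : ∀ n, Countable ((towerExtension L).Functions n) := fun n =>
    inferInstanceAs (Countable (L.Functions n ⊕ Empty))
  have h7 : ∀ n, Countable ((towerExtension L).Relations n) := fun n =>
    inferInstanceAs (Countable (L.Relations n ⊕ TowerRel n))
  exact inferInstanceAs (Countable ((Σ l, (towerExtension L).Functions l) ⊕
    (Σ l, (towerExtension L).Relations l)))

/-- Relativization of a formula to the base sort. -/
def InfFormula.relativize : {n : ℕ} → InfFormula L n → InfFormula (towerExtension L) n
  | _, falsum => falsum
  | _, equal t₁ t₂ => equal (FirstOrder.Language.LHom.sumInl.onTerm t₁)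
      (FirstOrder.Language.LHom.sumInl.onTerm t₂)
  | _, rel R ts => rel (baseRel R) fun i => FirstOrder.Language.LHom.sumInl.onTerm (ts i)
  | _, imp φ ψ => imp φ.relativize ψ.relativize
  | _, conj φ => conj fun i => (φ i).relativize
  | n, all φ => all (imp (rel TowerRel.base.rel fun _ => .var (Fin.last n)) φ.relativize)

open FirstOrder.Language

variable {M : Type u} [(towerExtension L).Structure M]

theorem relMap_base_iff (a : M) :
    Structure.RelMap (TowerRel.base.rel : (towerExtension L).Relations 1) (fun _ => a) ↔
      a ∈ predSet M (TowerRel.base.rel : (towerExtension L).Relations 1) :=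
  iff_of_eq (congrArg _ (funext fun j => by fin_cases j; rfl))

theorem InfFormula.realize_relativize {S : Type u} [L.Structure S] (j : S → M)
    (hj : Function.Injective j)
    (hrange : ∀ a, a ∈ predSet M (TowerRel.base.rel : (towerExtension L).Relations 1) ↔
      ∃ s, j s = a)
    (hfun : ∀ (n : ℕ) (f : L.Functions n) (v : Fin n → S),
      j (Structure.funMap f v) = Structure.funMap (baseFun f) fun i => j (v i))
    (hrel : ∀ (n : ℕ) (R : L.Relations n) (v : Fin n → S),
      Structure.RelMap R v ↔ Structure.RelMap (baseRel R) fun i => j (v i))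
    {n : ℕ} (φ : InfFormula L n) :
    ∀ v : Fin n → S, φ.Realize S v ↔ φ.relativize.Realize M fun i => j (v i) := by
  have hterm : ∀ {n : ℕ} (t : L.Term (Fin n)) (v : Fin n → S),
      (LHom.sumInl.onTerm t : (towerExtension L).Term (Fin n)).realize (fun i => j (v i)) =
        j (t.realize v) := by
    intro n t v
    induction t with
    | var i => rfl
    | func f ts ih =>
      simp only [LHom.onTerm, Term.realize, ih]
      exact (hfun _ f _).symm
  induction φ with
  | falsum => intro v; rfl
  | equal t₁ t₂ =>
    intro v
    simp only [Realize, relativize, hterm, hj.eq_iff]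
  | rel R ts =>
    intro v
    simp only [Realize, relativize, hterm]
    exact hrel _ R _
  | imp φ ψ h₁ h₂ => intro v; simp only [Realize, relativize, h₁ v, h₂ v]
  | conj φ h => intro v; simp only [Realize, relativize, fun i => h i v]
  | @all n φ h =>
    intro v
    have key : ∀ s : S, φ.Realize S (Fin.snoc v s) ↔
        φ.relativize.Realize M (Fin.snoc (fun i => j (v i)) (j s)) := by
      intro s
      rw [h]
      have : (fun i => j (Fin.snoc (α := fun _ => S) v s i)) = Fin.snoc (fun i => j (v i)) (j s) :=
        Fin.comp_snoc j v s
      rw [this]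
    simp only [Realize, relativize, Term.realize_var, Fin.snoc_last, key]
    constructor
    · intro h' a ha
      obtain ⟨s, rfl⟩ := (hrange a).1 ((relMap_base_iff a).1 ha)
      exact h' s
    · intro h' s
      exact h' (j s) ((relMap_base_iff _).2 ((hrange _).2 ⟨s, rfl⟩))

end Vocabulary

/-! ### Amalgams of a model of the base sentence with a tower. -/

section Amalgam

open FirstOrder.Language

variable {L : FirstOrder.Language.{0, 0}} (θ : InfSentence L) (P : L.Relations 1)

/-- The interpretation of a unary symbol for the tower. -/
abbrev towerSort (L : FirstOrder.Language.{0, 0}) (M : Type u) [(towerExtension L).Structure M]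
    (R : TowerRel 1) : Set M :=
  predSet M (R.rel : (towerExtension L).Relations 1)

/-- The universe is partitioned into a model of `θ`, an ordered sort and a sort of
indiscernibles, and the latter two form a tower with the predicate `P` of the former. -/
structure IsAmalgam (M : Type u) [(towerExtension L).Structure M] : Prop where
  cover : ∀ a : M, a ∈ towerSort L M .base ∨ a ∈ towerSort L M .ordered ∨
    a ∈ towerSort L M .indisc
  not_ordered : ∀ a ∈ towerSort L M .base, a ∉ towerSort L M .ordered
  not_indisc : ∀ a ∈ towerSort L M .base, a ∉ towerSort L M .indisc
  not_indisc' : ∀ a ∈ towerSort L M .ordered, a ∉ towerSort L M .indisc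
  fun_mem : ∀ (n : ℕ) (f : L.Functions n) (v : Fin n → M), (∀ i, v i ∈ towerSort L M .base) →
    Structure.funMap (baseFun f) v ∈ towerSort L M .base
  -- Old functions need a definite value off the base sort, as otherwise categoricity would fail.
  -- Constants are excluded here, since the preceding clause already places them in the base.
  fun_eq : ∀ (n : ℕ) (f : L.Functions (n + 1)) (v : Fin (n + 1) → M),
    ¬ (∀ i, v i ∈ towerSort L M .base) → Structure.funMap (baseFun f) v = v 0
  rel_mem : ∀ (n : ℕ) (R : L.Relations n) (v : Fin n → M), Structure.RelMap (baseRel R) v →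
    ∀ i, v i ∈ towerSort L M .base
  tower : IsSortedTower (predSet M (baseRel P)) (towerSort L M .ordered) (towerSort L M .indisc)
    (binRel M (TowerRel.lt.rel : (towerExtension L).Relations 2))
    (binRel M (TowerRel.pr.rel : (towerExtension L).Relations 2))
    (terRel M (TowerRel.F.rel : (towerExtension L).Relations 3))
  realize : θ.relativize.Realize M Fin.elim0

open InfDefinable in
theorem exists_amalgam_sentence [Countable L.Symbols] :
    ∃ χ : InfSentence (towerExtension L), ∀ (M : Type u) [(towerExtension L).Structure M],
      χ.Realize M Fin.elim0 ↔ IsAmalgam θ P M := by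
  have h3 := countable_functions L
  have h4 := countable_relations L
  have hθ : InfDefinable.{u} (towerExtension L) (n := 0) fun M _ v =>
      θ.relativize.Realize M Fin.elim0 :=
    ⟨θ.relativize, fun M _ v => by rw [Subsingleton.elim v]⟩
  have hsort : InfDefinable.{u} (towerExtension L) (n := 0) fun M _ _ =>
      (∀ a : M, a ∈ towerSort L M .base ∨ a ∈ towerSort L M .ordered ∨
        a ∈ towerSort L M .indisc) ∧
      (∀ a, a ∈ towerSort L M .base → ¬ a ∈ towerSort L M .ordered) ∧
      (∀ a, a ∈ towerSort L M .base → ¬ a ∈ towerSort L M .indisc) ∧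
      (∀ a, a ∈ towerSort L M .ordered → ¬ a ∈ towerSort L M .indisc) ∧
      (∀ (n : ℕ) (f : L.Functions n) (v : Fin n → M), (∀ i, v i ∈ towerSort L M .base) →
        ∀ b, Structure.funMap (baseFun f) v = b → b ∈ towerSort L M .base) ∧
      (∀ (n : ℕ) (f : L.Functions (n + 1)) (v : Fin (n + 1) → M),
        ¬ (∀ i, v i ∈ towerSort L M .base) → Structure.funMap (baseFun f) v = v 0) ∧
      (∀ (n : ℕ) (R : L.Relations n) (v : Fin n → M), Structure.RelMap (baseRel R) v →
        ∀ i, v i ∈ towerSort L M .base) := by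
    repeat' first
      | exact mem_predSet _ _
      | exact InfDefinable.rel _ _
      | exact InfDefinable.funMap_eq _ _ _
      | apply InfDefinable.and
      | apply InfDefinable.or
      | apply InfDefinable.not
      | apply InfDefinable.all
      | apply InfDefinable.allTuple
      | apply InfDefinable.imp
      | (refine InfDefinable.forall_countable fun _ => ?_)
  obtain ⟨χ, hχ⟩ := (hsort.and (hθ.and (infDefinable_isSortedTower
    (L := towerExtension L) (baseRel P) TowerRel.ordered.rel TowerRel.indisc.rel
    TowerRel.lt.rel TowerRel.pr.rel TowerRel.F.rel)))
  refine ⟨χ, fun M _ => (hχ M Fin.elim0).trans ⟨?_, ?_⟩⟩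
  · rintro ⟨⟨h1, h2, h3, h4, h5, h6, h7⟩, h8, h9⟩
    exact ⟨h1, h2, h3, h4, fun n f v hv => h5 n f v hv _ rfl, h6, h7, h9, h8⟩
  · rintro ⟨h1, h2, h3, h4, h5, h6, h7, h8, h9⟩
    exact ⟨⟨h1, h2, h3, h4, fun n f v hv b hb => hb ▸ h5 n f v hv, h6, h7⟩, h9, h8⟩

namespace IsAmalgam

variable {θ P} {M : Type u} [(towerExtension L).Structure M]

/-- The model of `θ` in an amalgam. -/
abbrev baseStructure (h : IsAmalgam θ P M) : L.Structure (towerSort L M .base) where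
  funMap f v := ⟨Structure.funMap (baseFun f) fun i => (v i : M), h.fun_mem _ f _ fun i => (v i).2⟩
  RelMap R v := Structure.RelMap (baseRel R) fun i => (v i : M)

theorem predSet_subset (h : IsAmalgam θ P M) :
    predSet M (baseRel P : (towerExtension L).Relations 1) ⊆ towerSort L M .base :=
  fun _ ha => h.rel_mem 1 P _ ha 0

theorem mem_predSet_base (h : IsAmalgam θ P M) (a : towerSort L M .base) :
    letI := h.baseStructure
    a ∈ predSet (towerSort L M .base) P ↔
      (a : M) ∈ predSet M (baseRel P : (towerExtension L).Relations 1) :=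
  iff_of_eq (congrArg (Structure.RelMap (baseRel P))
    (funext fun j => by fin_cases j; rfl))

theorem isModel_base (h : IsAmalgam θ P M) :
    letI := h.baseStructure
    IsModel (towerSort L M .base) θ := by
  let _ := h.baseStructure
  have hne : Nonempty (predSet M (baseRel P : (towerExtension L).Relations 1)) := by
    rw [← Cardinal.mk_ne_zero_iff]
    exact (Cardinal.aleph0_pos.trans_le h.tower.isTower.aleph0_le_mk_X).ne'
  obtain ⟨x⟩ := hne
  refine ⟨⟨⟨x, h.predSet_subset x.2⟩⟩, ?_⟩
  rw [InfFormula.realize_relativize (M := M) Subtype.val Subtype.val_injective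
    (fun a => ⟨fun ha => ⟨⟨a, ha⟩, rfl⟩, fun ⟨s, hs⟩ => hs ▸ s.2⟩)
    (fun _ _ _ => rfl) (fun _ _ _ => Iff.rfl)]
  rw [Subsingleton.elim (fun i => _) Fin.elim0]
  exact h.realize

/-- An amalgam is the disjoint union of its three sorts. -/
noncomputable def sumEquiv (h : IsAmalgam θ P M) :
    towerSort L M .base ⊕ (towerSort L M .ordered ⊕ towerSort L M .indisc) ≃ M :=
  Equiv.ofBijective (Sum.elim Subtype.val (Sum.elim Subtype.val Subtype.val)) <| by
    constructor
    · rintro (⟨a, ha⟩ | ⟨a, ha⟩ | ⟨a, ha⟩) (⟨b, hb⟩ | ⟨b, hb⟩ | ⟨b, hb⟩) (rfl : a = b)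
      · rfl
      · exact (h.not_ordered a ha hb).elim
      · exact (h.not_indisc a ha hb).elim
      · exact (h.not_ordered a hb ha).elim
      · rfl
      · exact (h.not_indisc' a ha hb).elim
      · exact (h.not_indisc a hb ha).elim
      · exact (h.not_indisc' a hb ha).elim
      · rfl
    · intro a
      rcases h.cover a with ha | ha | ha
      · exact ⟨.inl ⟨a, ha⟩, rfl⟩
      · exact ⟨.inr (.inl ⟨a, ha⟩), rfl⟩
      · exact ⟨.inr (.inr ⟨a, ha⟩), rfl⟩

theorem mk_eq (h : IsAmalgam θ P M) : #M = #(towerSort L M .base) +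
    (#(towerSort L M .ordered) + #(towerSort L M .indisc)) := by
  rw [← Cardinal.mk_congr h.sumEquiv]
  simp

theorem hasOrderedSort (h : IsAmalgam θ P M) :
    HasOrderedSort M (baseRel P : (towerExtension L).Relations 1) TowerRel.ordered.rel
      TowerRel.indisc.rel TowerRel.lt.rel := by
  have hT := h.tower.isTower
  refine ⟨?_, ?_, ?_, ?_, ?_, ?_, ?_, ?_, ?_, ?_, ?_⟩
  · exact Set.disjoint_left.2 fun a ha => h.not_ordered a (h.predSet_subset ha)
  · exact Set.disjoint_left.2 fun a ha => h.not_indisc a (h.predSet_subset ha)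
  · exact Set.disjoint_left.2 h.not_indisc'
  · obtain ⟨y, -⟩ := hT.extend_Y ∅ ∅ ∅ (fun _ _ => False) (by simp) (by simp) (by simp)
    exact ⟨y, y.2⟩
  · exact fun a _ => h.tower.irrefl a
  · exact fun a _ b _ c _ => h.tower.trans a b c
  · exact h.tower.total
  · intro a ha b hb hab
    obtain ⟨y, h1, h2, -⟩ := hT.extend_Y ∅ {⟨a, ha⟩} {⟨b, hb⟩} (fun _ _ => False)
      (by simpa using hab) (by simp) (by simp)
    exact ⟨y, y.2, h1 _ (Finset.mem_singleton_self _), h2 _ (Finset.mem_singleton_self _)⟩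
  · intro a ha
    obtain ⟨y, -, h2, -⟩ := hT.extend_Y ∅ ∅ {⟨a, ha⟩} (fun _ _ => False)
      (by simp) (by simp) (by simp)
    exact ⟨y, y.2, h2 _ (Finset.mem_singleton_self _)⟩
  · intro a ha
    obtain ⟨y, h1, -, -⟩ := hT.extend_Y ∅ {⟨a, ha⟩} ∅ (fun _ _ => False)
      (by simp) (by simp) (by simp)
    exact ⟨y, y.2, h1 _ (Finset.mem_singleton_self _)⟩
  · intro a ha
    refine le_trans ?_ (hT.mk_pred_le ⟨a, ha⟩)
    exact Cardinal.mk_le_of_injective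
      (f := fun b : {b : M // b ∈ predSet M (TowerRel.ordered.rel : (towerExtension L).Relations 1) ∧
        binRel M TowerRel.lt.rel b a} => ⟨⟨b.1, b.2.1⟩, b.2.2⟩)
      fun b c hbc => Subtype.ext (by simpa using hbc)

end IsAmalgam

/-- In the countable models of a complete sentence with absolute indiscernibles, every bijection
of the indiscernibles extends to an isomorphism. -/
theorem exists_equiv_extending {θ : InfSentence L} {P : L.Relations 1}
    (hθ : IsCompleteSentence.{u} θ)
    (hP : ∀ (M : Type u) [L.Structure M], Countable M → IsModel M θ → IsAbsIndiscernible M P)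
    {M N : Type u} [L.Structure M] [L.Structure N] [Countable M] [Countable N]
    (hM : IsModel M θ) (hN : IsModel N θ) (f : predSet M P ≃ predSet N P) :
    ∃ e : M ≃[L] N, ∀ a : predSet M P, e (a : M) = (f a : N) := by
  obtain ⟨g⟩ := hθ.nonempty_equiv hM hN
  have hg : ∀ a, a ∈ predSet M P ↔ g a ∈ predSet N P := by
    intro a
    have := g.map_rel P ![a]
    have h2 : (g ∘ ![a] : Fin 1 → N) = ![g a] := funext fun j => by fin_cases j; rfl
    rw [h2] at this
    exact this.symm
  let gP : predSet M P ≃ predSet N P := g.toEquiv.subtypeEquiv hg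
  -- An arbitrary isomorphism is corrected by an automorphism of the target that permutes its
  -- indiscernibles.
  obtain ⟨k, hk⟩ := (hP N ‹_› hN).2 (gP.symm.trans f)
  refine ⟨k.comp g, fun a => ?_⟩
  have := hk (gP a)
  rw [Equiv.trans_apply, Equiv.symm_apply_apply] at this
  exact this

variable {θ P}

open Classical in
/-- Isomorphisms of the three sorts which respect the tower yield an isomorphism. -/
theorem IsAmalgam.exists_equiv_of_sorts {M N : Type u} [(towerExtension L).Structure M]
    [(towerExtension L).Structure N] (hM : IsAmalgam θ P M) (hN : IsAmalgam θ P N)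
    (g : letI := hM.baseStructure; letI := hN.baseStructure;
      towerSort L M .base ≃[L] towerSort L N .base)
    (gY : towerSort L M .ordered ≃ towerSort L N .ordered)
    (σ : towerSort L M .indisc ≃ towerSort L N .indisc)
    (hlt : ∀ a b : towerSort L M .ordered, binRel M (TowerRel.lt.rel : (towerExtension L).Relations 2) a b ↔
      binRel N (TowerRel.lt.rel : (towerExtension L).Relations 2) (gY a : N) (gY b : N))
    (hpr : ∀ (a : towerSort L M .base) (u : towerSort L M .indisc),
      binRel M (TowerRel.pr.rel : (towerExtension L).Relations 2) a u ↔
      binRel N (TowerRel.pr.rel : (towerExtension L).Relations 2) (g a : N) (σ u : N))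
    (hF : ∀ (a : towerSort L M .ordered) (x : towerSort L M .base) (b : towerSort L M .ordered),
      terRel M (TowerRel.F.rel : (towerExtension L).Relations 3) a x b ↔
      terRel N (TowerRel.F.rel : (towerExtension L).Relations 3) (gY a : N) (g x : N) (gY b : N)) :
    ∃ e : M ≃[towerExtension L] N, ∀ u : towerSort L M .indisc, e (u : M) = (σ u : N) := by
  let _ := hM.baseStructure
  let _ := hN.baseStructure
  let e : M ≃ N := hM.sumEquiv.symm.trans
    ((Equiv.sumCongr g.toEquiv (Equiv.sumCongr gY σ)).trans hN.sumEquiv)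
  have heS : ∀ a : towerSort L M .base, e a = (g a : N) := by
    intro a
    have : hM.sumEquiv.symm (a : M) = .inl a := by rw [Equiv.symm_apply_eq]; rfl
    simp only [e, Equiv.trans_apply, this]
    rfl
  have heY : ∀ a : towerSort L M .ordered, e a = (gY a : N) := by
    intro a
    have : hM.sumEquiv.symm (a : M) = .inr (.inl a) := by rw [Equiv.symm_apply_eq]; rfl
    simp only [e, Equiv.trans_apply, this]
    rfl
  have heU : ∀ a : towerSort L M .indisc, e a = (σ a : N) := by
    intro a
    have : hM.sumEquiv.symm (a : M) = .inr (.inr a) := by rw [Equiv.symm_apply_eq]; rfl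
    simp only [e, Equiv.trans_apply, this]
    rfl
  have hS : ∀ a, e a ∈ towerSort L N .base ↔ a ∈ towerSort L M .base := by
    intro a
    rcases hM.cover a with ha | ha | ha
    · refine iff_of_true ?_ ha
      rw [heS ⟨a, ha⟩]
      exact (g ⟨a, ha⟩).2
    · refine iff_of_false (fun h => hN.not_ordered _ h ?_) fun h => hM.not_ordered a h ha
      rw [heY ⟨a, ha⟩]
      exact (gY ⟨a, ha⟩).2
    · refine iff_of_false (fun h => hN.not_indisc _ h ?_) fun h => hM.not_indisc a h ha
      rw [heU ⟨a, ha⟩]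
      exact (σ ⟨a, ha⟩).2
  have hY : ∀ a, e a ∈ towerSort L N .ordered ↔ a ∈ towerSort L M .ordered := by
    intro a
    rcases hM.cover a with ha | ha | ha
    · exact iff_of_false (hN.not_ordered _ ((hS a).2 ha)) (hM.not_ordered a ha)
    · refine iff_of_true ?_ ha
      rw [heY ⟨a, ha⟩]
      exact (gY ⟨a, ha⟩).2
    · refine iff_of_false (fun h => hN.not_indisc' _ h ?_) fun h => hM.not_indisc' a h ha
      rw [heU ⟨a, ha⟩]
      exact (σ ⟨a, ha⟩).2
  have hU : ∀ a, e a ∈ towerSort L N .indisc ↔ a ∈ towerSort L M .indisc := by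
    intro a
    rcases hM.cover a with ha | ha | ha
    · exact iff_of_false (hN.not_indisc _ ((hS a).2 ha)) (hM.not_indisc a ha)
    · exact iff_of_false (hN.not_indisc' _ ((hY a).2 ha)) (hM.not_indisc' a ha)
    · refine iff_of_true ?_ ha
      rw [heU ⟨a, ha⟩]
      exact (σ ⟨a, ha⟩).2
  have hlt' : ∀ a b, binRel N (TowerRel.lt.rel : (towerExtension L).Relations 2) (e a) (e b) ↔
      binRel M (TowerRel.lt.rel : (towerExtension L).Relations 2) a b := by
    intro a b
    by_cases hab : a ∈ towerSort L M .ordered ∧ b ∈ towerSort L M .ordered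
    · rw [heY ⟨a, hab.1⟩, heY ⟨b, hab.2⟩]
      exact (hlt ⟨a, hab.1⟩ ⟨b, hab.2⟩).symm
    · refine iff_of_false (fun h => hab ?_) fun h => hab (hM.tower.lt_mem _ _ h)
      rw [← hY, ← hY]
      exact hN.tower.lt_mem _ _ h
  have hpr' : ∀ a b, binRel N (TowerRel.pr.rel : (towerExtension L).Relations 2) (e a) (e b) ↔
      binRel M (TowerRel.pr.rel : (towerExtension L).Relations 2) a b := by
    intro a b
    by_cases hab : a ∈ towerSort L M .base ∧ b ∈ towerSort L M .indisc
    · rw [heS ⟨a, hab.1⟩, heU ⟨b, hab.2⟩]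
      exact (hpr ⟨a, hab.1⟩ ⟨b, hab.2⟩).symm
    · refine iff_of_false (fun h => hab ?_) fun h => hab ?_
      · rw [← hS, ← hU]
        exact ⟨hN.predSet_subset (hN.tower.pr_mem _ _ h).1, (hN.tower.pr_mem _ _ h).2⟩
      · exact ⟨hM.predSet_subset (hM.tower.pr_mem _ _ h).1, (hM.tower.pr_mem _ _ h).2⟩
  have hF' : ∀ a b c,
      terRel N (TowerRel.F.rel : (towerExtension L).Relations 3) (e a) (e b) (e c) ↔
      terRel M (TowerRel.F.rel : (towerExtension L).Relations 3) a b c := by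
    intro a b c
    by_cases hab : a ∈ towerSort L M .ordered ∧ b ∈ towerSort L M .base ∧
        c ∈ towerSort L M .ordered
    · rw [heY ⟨a, hab.1⟩, heS ⟨b, hab.2.1⟩, heY ⟨c, hab.2.2⟩]
      exact (hF ⟨a, hab.1⟩ ⟨b, hab.2.1⟩ ⟨c, hab.2.2⟩).symm
    · refine iff_of_false (fun h => hab ?_) fun h => hab ?_
      · have := hN.tower.F_mem _ _ _ h
        rw [← hY, ← hS, ← hY]
        exact ⟨this.1, hN.predSet_subset this.2.1, this.2.2⟩
      · have := hM.tower.F_mem _ _ _ h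
        exact ⟨this.1, hM.predSet_subset this.2.1, this.2.2⟩
  have hall : ∀ {n : ℕ} (v : Fin n → M), (∀ i, e (v i) ∈ towerSort L N .base) ↔
      ∀ i, v i ∈ towerSort L M .base := fun v => forall_congr' fun i => hS (v i)
  refine ⟨⟨e, fun {n} f v => ?_, fun {n} R v => ?_⟩, heU⟩
  · rcases f with f | f
    · by_cases hv : ∀ i, v i ∈ towerSort L M .base
      · have h1 := congrArg Subtype.val (g.map_fun f fun i => ⟨v i, hv i⟩)
        refine (heS ⟨_, hM.fun_mem _ f v hv⟩).trans (h1.trans ?_)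
        exact congrArg (Structure.funMap (baseFun f)) (funext fun i => (heS ⟨v i, hv i⟩).symm)
      · cases n with
        | zero => exact (hv fun i => i.elim0).elim
        | succ n =>
          refine (congrArg e (hM.fun_eq n f v hv)).trans (hN.fun_eq n f (e ∘ v) ?_).symm
          exact fun h => hv ((hall v).1 h)
    · exact f.elim
  · have e1 : ∀ w : Fin 1 → M, w = ![w 0] ∧ (e ∘ w) = ![e (w 0)] := fun w =>
      ⟨funext fun j => by fin_cases j; rfl, funext fun j => by fin_cases j; rfl⟩
    have e2 : ∀ w : Fin 2 → M, w = ![w 0, w 1] ∧ (e ∘ w) = ![e (w 0), e (w 1)] := fun w =>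
      ⟨funext fun j => by fin_cases j <;> rfl, funext fun j => by fin_cases j <;> rfl⟩
    have e3 : ∀ w : Fin 3 → M, w = ![w 0, w 1, w 2] ∧
        (e ∘ w) = ![e (w 0), e (w 1), e (w 2)] := fun w =>
      ⟨funext fun j => by fin_cases j <;> rfl, funext fun j => by fin_cases j <;> rfl⟩
    rcases R with R | R
    · change Structure.RelMap (baseRel R) (e ∘ v) ↔ Structure.RelMap (baseRel R) v
      by_cases hv : ∀ i, v i ∈ towerSort L M .base
      · have h1 := g.map_rel R fun i => ⟨v i, hv i⟩
        have h2 : (e ∘ v) = fun i => ((g ⟨v i, hv i⟩ : towerSort L N .base) : N) :=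
          funext fun i => heS ⟨v i, hv i⟩
        rw [h2]
        exact h1
      · exact iff_of_false (fun h => hv ((hall v).1 (hN.rel_mem _ R _ h)))
          fun h => hv (hM.rel_mem _ R _ h)
    · cases R with
      | base =>
        change Structure.RelMap (TowerRel.base.rel : (towerExtension L).Relations 1) (e ∘ v) ↔
          Structure.RelMap (TowerRel.base.rel : (towerExtension L).Relations 1) v
        rw [(e1 v).2, (e1 v).1]
        exact hS (v 0)
      | ordered =>
        change Structure.RelMap (TowerRel.ordered.rel : (towerExtension L).Relations 1) (e ∘ v) ↔
          Structure.RelMap (TowerRel.ordered.rel : (towerExtension L).Relations 1) v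
        rw [(e1 v).2, (e1 v).1]
        exact hY (v 0)
      | indisc =>
        change Structure.RelMap (TowerRel.indisc.rel : (towerExtension L).Relations 1) (e ∘ v) ↔
          Structure.RelMap (TowerRel.indisc.rel : (towerExtension L).Relations 1) v
        rw [(e1 v).2, (e1 v).1]
        exact hU (v 0)
      | lt =>
        change Structure.RelMap (TowerRel.lt.rel : (towerExtension L).Relations 2) (e ∘ v) ↔
          Structure.RelMap (TowerRel.lt.rel : (towerExtension L).Relations 2) v
        rw [(e2 v).2, (e2 v).1]
        exact hlt' (v 0) (v 1)
      | pr =>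
        change Structure.RelMap (TowerRel.pr.rel : (towerExtension L).Relations 2) (e ∘ v) ↔
          Structure.RelMap (TowerRel.pr.rel : (towerExtension L).Relations 2) v
        rw [(e2 v).2, (e2 v).1]
        exact hpr' (v 0) (v 1)
      | F =>
        change Structure.RelMap (TowerRel.F.rel : (towerExtension L).Relations 3) (e ∘ v) ↔
          Structure.RelMap (TowerRel.F.rel : (towerExtension L).Relations 3) v
        rw [(e3 v).2, (e3 v).1]
        exact hF' (v 0) (v 1) (v 2)

/-- Countable amalgams are isomorphic, over any bijection of the sorts of indiscernibles. -/
theorem IsAmalgam.exists_equiv (hθ : IsCompleteSentence.{u} θ)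
    (hP : ∀ (M : Type u) [L.Structure M], Countable M → IsModel M θ → IsAbsIndiscernible M P)
    {M N : Type u} [(towerExtension L).Structure M] [(towerExtension L).Structure N]
    [Countable M] [Countable N] (hM : IsAmalgam θ P M) (hN : IsAmalgam θ P N)
    (σ : towerSort L M .indisc ≃ towerSort L N .indisc) :
    ∃ e : M ≃[towerExtension L] N, ∀ u : towerSort L M .indisc, e (u : M) = (σ u : N) := by
  let _ := hM.baseStructure
  let _ := hN.baseStructure
  obtain ⟨f, gY, hlt, hpr, hF⟩ := hM.tower.isTower.exists_equiv hN.tower.isTower σ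
  let iM : predSet (towerSort L M .base) P ≃
      predSet M (baseRel P : (towerExtension L).Relations 1) :=
    ⟨fun a => ⟨a.1.1, (hM.mem_predSet_base a.1).1 a.2⟩,
      fun a => ⟨⟨a.1, hM.predSet_subset a.2⟩, (hM.mem_predSet_base _).2 a.2⟩,
      fun _ => rfl, fun _ => rfl⟩
  let iN : predSet (towerSort L N .base) P ≃
      predSet N (baseRel P : (towerExtension L).Relations 1) :=
    ⟨fun a => ⟨a.1.1, (hN.mem_predSet_base a.1).1 a.2⟩,
      fun a => ⟨⟨a.1, hN.predSet_subset a.2⟩, (hN.mem_predSet_base _).2 a.2⟩,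
      fun _ => rfl, fun _ => rfl⟩
  -- The tower isomorphism may induce any bijection between the sets defined by `P`; absolute
  -- indiscernibility extends whatever it is to the base models.
  obtain ⟨g, hg⟩ := exists_equiv_extending hθ hP hM.isModel_base hN.isModel_base
    (iM.trans (f.trans iN.symm))
  have hgf : ∀ (a : M) (ha : a ∈ predSet M (baseRel P : (towerExtension L).Relations 1)),
      ((g ⟨a, hM.predSet_subset ha⟩ : towerSort L N .base) : N) = f ⟨a, ha⟩ := fun a ha =>
    congrArg Subtype.val (hg (iM.symm ⟨a, ha⟩))
  -- Off `P` the projection and the functions must fail on both sides, so `g` has to reflect `P`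
  -- too.
  have hgP : ∀ a : towerSort L M .base,
      ((g a : towerSort L N .base) : N) ∈ predSet N (baseRel P : (towerExtension L).Relations 1) →
      (a : M) ∈ predSet M (baseRel P : (towerExtension L).Relations 1) := by
    intro a ha
    rw [← hM.mem_predSet_base]
    have h1 := (hN.mem_predSet_base _).2 ha
    have h2 := g.map_rel P ![a]
    have h3 : (g ∘ ![a] : Fin 1 → towerSort L N .base) = ![g a] :=
      funext fun j => by fin_cases j; rfl
    rw [h3] at h2
    exact h2.1 h1
  refine hM.exists_equiv_of_sorts hN g gY σ hlt (fun a u => ?_) fun a x b => ?_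
  · by_cases ha : (a : M) ∈ predSet M (baseRel P : (towerExtension L).Relations 1)
    · rw [show a = ⟨a, hM.predSet_subset ha⟩ from rfl, hgf _ ha]
      exact hpr ⟨a, ha⟩ u
    · exact iff_of_false (fun h => ha (hM.tower.pr_mem _ _ h).1)
        fun h => ha (hgP a (hN.tower.pr_mem _ _ h).1)
  · by_cases hx : (x : M) ∈ predSet M (baseRel P : (towerExtension L).Relations 1)
    · rw [show x = ⟨x, hM.predSet_subset hx⟩ from rfl, hgf _ hx]
      exact hF a ⟨x, hx⟩ b
    · exact iff_of_false (fun h => hx (hM.tower.F_mem _ _ _ h).2.1)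
        fun h => hx (hgP x (hN.tower.F_mem _ _ _ h).2.1)

end Amalgam

/-! ### Amalgams exist over every model with infinite `P`. -/

section Construction

open FirstOrder.Language

variable {L : FirstOrder.Language.{0, 0}} {S Y U : Type u} [L.Structure S] {P : L.Relations 1}

open Classical in
/-- The disjoint union of a structure and the remaining sorts of a tower. -/
noncomputable abbrev sumTowerStructure (lt : Y → Y → Prop) (pr : predSet S P → U → Prop)
    (F : Y → predSet S P → Y → Prop) : (towerExtension L).Structure (S ⊕ (Y ⊕ U)) where
  funMap f v := match f with
    | .inl f =>
      if h : ∀ i, ∃ s, v i = .inl s then .inl (Structure.funMap f fun i => (h i).choose)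
      -- An argument outside the base exists, so the arity is positive and the first argument can
      -- serve as default value.
      else v ⟨0, (not_forall.1 h).choose.pos⟩
    | .inr f => f.elim
  RelMap R v := match R with
    | .inl R => ∃ w : Fin _ → S, v = (fun i => .inl (w i)) ∧ Structure.RelMap R w
    | .inr .base => ∃ s, v 0 = .inl s
    | .inr .ordered => ∃ y, v 0 = .inr (.inl y)
    | .inr .indisc => ∃ z, v 0 = .inr (.inr z)
    | .inr .lt => ∃ a b, v 0 = .inr (.inl a) ∧ v 1 = .inr (.inl b) ∧ lt a b
    | .inr .pr => ∃ a b, v 0 = .inl a.1 ∧ v 1 = .inr (.inr b) ∧ pr a b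
    | .inr .F => ∃ a x b, v 0 = .inr (.inl a) ∧ v 1 = .inl x.1 ∧ v 2 = .inr (.inl b) ∧ F a x b

theorem IsTower.isAmalgam_sum {θ : InfSentence L} (hS : IsModel S θ) {lt : Y → Y → Prop}
    {pr : predSet S P → U → Prop} {F : Y → predSet S P → Y → Prop} (hT : IsTower lt pr F) :
    letI := sumTowerStructure lt pr F
    IsAmalgam θ P (S ⊕ (Y ⊕ U)) ∧
      #(predSet (S ⊕ (Y ⊕ U)) (baseRel P : (towerExtension L).Relations 1)) = #(predSet S P) ∧
      #(towerSort L (S ⊕ (Y ⊕ U)) .indisc) = #U := by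
  let _ := sumTowerStructure lt pr F
  have hbase : ∀ a : S ⊕ (Y ⊕ U), a ∈ towerSort L (S ⊕ (Y ⊕ U)) .base ↔ ∃ s, a = .inl s :=
    fun a => Iff.rfl
  have hord : ∀ a : S ⊕ (Y ⊕ U), a ∈ towerSort L (S ⊕ (Y ⊕ U)) .ordered ↔
      ∃ y, a = .inr (.inl y) := fun a => Iff.rfl
  have hind : ∀ a : S ⊕ (Y ⊕ U), a ∈ towerSort L (S ⊕ (Y ⊕ U)) .indisc ↔
      ∃ z, a = .inr (.inr z) := fun a => Iff.rfl
  have hrel : ∀ {n : ℕ} (R : L.Relations n) (w : Fin n → S),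
      Structure.RelMap (baseRel R) (fun i => (.inl (w i) : S ⊕ (Y ⊕ U))) ↔
        Structure.RelMap R w := by
    intro n R w
    refine ⟨fun ⟨w', h1, h2⟩ => ?_, fun h => ⟨w, rfl, h⟩⟩
    have : w = w' := funext fun i => Sum.inl_injective (congrFun h1 i)
    rwa [this]
  have hfun : ∀ {n : ℕ} (f : L.Functions n) (w : Fin n → S),
      Structure.funMap (baseFun f) (fun i => (.inl (w i) : S ⊕ (Y ⊕ U))) =
        .inl (Structure.funMap f w) := by
    intro n f w
    have h : ∀ i, ∃ s, (.inl (w i) : S ⊕ (Y ⊕ U)) = .inl s := fun i => ⟨w i, rfl⟩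
    refine (dif_pos h).trans ?_
    congr 2
    funext i
    exact (Sum.inl_injective (h i).choose_spec).symm
  have hP : ∀ a : S ⊕ (Y ⊕ U), a ∈ predSet (S ⊕ (Y ⊕ U))
      (baseRel P : (towerExtension L).Relations 1) ↔ ∃ s ∈ predSet S P, a = .inl s := by
    intro a
    constructor
    · rintro ⟨w, h1, h2⟩
      refine ⟨w 0, ?_, congrFun h1 0⟩
      have : ![w 0] = w := funext fun i => by fin_cases i; rfl
      rw [← this] at h2
      exact h2
    · rintro ⟨s, hs, rfl⟩
      exact ⟨![s], funext fun i => by fin_cases i; rfl, hs⟩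
  let fX : predSet (S ⊕ (Y ⊕ U)) (baseRel P : (towerExtension L).Relations 1) ≃ predSet S P :=
    (Equiv.ofBijective (fun s : predSet S P => (⟨.inl s.1, (hP _).2 ⟨s.1, s.2, rfl⟩⟩ :
      predSet (S ⊕ (Y ⊕ U)) (baseRel P : (towerExtension L).Relations 1)))
      ⟨fun s t h => Subtype.ext (Sum.inl_injective (congrArg Subtype.val h)), fun ⟨a, ha⟩ => by
        obtain ⟨s, hs, rfl⟩ := (hP a).1 ha
        exact ⟨⟨s, hs⟩, rfl⟩⟩).symm
  let fY : towerSort L (S ⊕ (Y ⊕ U)) .ordered ≃ Y :=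
    (Equiv.ofBijective (fun y : Y => (⟨.inr (.inl y), y, rfl⟩ :
      towerSort L (S ⊕ (Y ⊕ U)) .ordered))
      ⟨fun s t h => Sum.inl_injective (Sum.inr_injective (congrArg Subtype.val h)), fun ⟨a, ha⟩ => by
        obtain ⟨s, rfl⟩ := (hord a).1 ha
        exact ⟨s, rfl⟩⟩).symm
  let fU : towerSort L (S ⊕ (Y ⊕ U)) .indisc ≃ U :=
    (Equiv.ofBijective (fun z : U => (⟨.inr (.inr z), z, rfl⟩ :
      towerSort L (S ⊕ (Y ⊕ U)) .indisc))
      ⟨fun s t h => Sum.inr_injective (Sum.inr_injective (congrArg Subtype.val h)), fun ⟨a, ha⟩ => by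
        obtain ⟨s, rfl⟩ := (hind a).1 ha
        exact ⟨s, rfl⟩⟩).symm
  have hfX : ∀ x, (fX.symm x : S ⊕ (Y ⊕ U)) = .inl x.1 := fun _ => rfl
  have hfY : ∀ y, (fY.symm y : S ⊕ (Y ⊕ U)) = .inr (.inl y) := fun _ => rfl
  have hfU : ∀ z, (fU.symm z : S ⊕ (Y ⊕ U)) = .inr (.inr z) := fun _ => rfl
  refine ⟨⟨?_, ?_, ?_, ?_, ?_, ?_, ?_, ?_, ?_⟩, Cardinal.mk_congr fX, Cardinal.mk_congr fU⟩
  · rintro (s | y | z)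
    · exact Or.inl ⟨s, rfl⟩
    · exact Or.inr (Or.inl ⟨y, rfl⟩)
    · exact Or.inr (Or.inr ⟨z, rfl⟩)
  · intro a ha hb
    obtain ⟨s, rfl⟩ := (hbase a).1 ha
    obtain ⟨t, ht⟩ := (hord _).1 hb
    cases ht
  · intro a ha hb
    obtain ⟨s, rfl⟩ := (hbase a).1 ha
    obtain ⟨t, ht⟩ := (hind _).1 hb
    cases ht
  · intro a ha hb
    obtain ⟨s, rfl⟩ := (hord a).1 ha
    obtain ⟨t, ht⟩ := (hind _).1 hb
    cases ht
  · intro n f v hv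
    choose w hw using fun i => (hbase _).1 (hv i)
    rw [show v = fun i => .inl (w i) from funext hw, hfun]
    exact ⟨_, rfl⟩
  · intro n f v hv
    exact dif_neg hv
  · rintro n R v ⟨w, rfl, -⟩ i
    exact ⟨w i, rfl⟩
  · refine IsTower.isSortedTower ?_ ?_ ?_ (hT.of_equiv fX fY fU ?_ ?_ ?_)
    · rintro a b ⟨a', b', ha, hb, -⟩
      exact ⟨⟨a', ha⟩, ⟨b', hb⟩⟩
    · rintro a b ⟨a', b', ha, hb, -⟩
      exact ⟨(hP a).2 ⟨a'.1, a'.2, ha⟩, ⟨b', hb⟩⟩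
    · rintro a x b ⟨a', x', b', ha, hx, hb, -⟩
      exact ⟨⟨a', ha⟩, (hP x).2 ⟨x'.1, x'.2, hx⟩, ⟨b', hb⟩⟩
    · intro a b
      obtain ⟨a, rfl⟩ := fY.symm.surjective a
      obtain ⟨b, rfl⟩ := fY.symm.surjective b
      rw [fY.apply_symm_apply, fY.apply_symm_apply, hfY, hfY]
      refine ⟨?_, fun h => ⟨a, b, rfl, rfl, h⟩⟩
      rintro ⟨a', b', ha, hb, h⟩
      cases ha
      cases hb
      exact h
    · intro x z
      obtain ⟨x, rfl⟩ := fX.symm.surjective x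
      obtain ⟨z, rfl⟩ := fU.symm.surjective z
      rw [fX.apply_symm_apply, fU.apply_symm_apply, hfX, hfU]
      refine ⟨?_, fun h => ⟨x, z, rfl, rfl, h⟩⟩
      rintro ⟨x', z', hx, hz, h⟩
      cases Subtype.ext (Sum.inl_injective hx)
      cases hz
      exact h
    · intro a x b
      obtain ⟨a, rfl⟩ := fY.symm.surjective a
      obtain ⟨x, rfl⟩ := fX.symm.surjective x
      obtain ⟨b, rfl⟩ := fY.symm.surjective b
      rw [fY.apply_symm_apply, fX.apply_symm_apply, fY.apply_symm_apply, hfY, hfX, hfY]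
      refine ⟨?_, fun h => ⟨a, x, b, rfl, rfl, rfl, h⟩⟩
      rintro ⟨a', x', b', ha, hx, hb, h⟩
      cases ha
      cases Subtype.ext (Sum.inl_injective hx)
      cases hb
      exact h
  · have := (InfFormula.realize_relativize (M := S ⊕ (Y ⊕ U)) (S := S) Sum.inl Sum.inl_injective
      (fun a => (hbase a).trans (exists_congr fun s => eq_comm))
      (fun _ f v => (hfun f v).symm) (fun _ R v => (hrel R v).symm) θ Fin.elim0).1 hS.2
    rwa [Subsingleton.elim (fun i : Fin 0 => (Sum.inl (Fin.elim0 i) : S ⊕ (Y ⊕ U))) Fin.elim0]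
      at this

theorem exists_isAmalgam {θ : InfSentence L} (hS : IsModel S θ) (hP : ℵ₀ ≤ #(predSet S P)) :
    ∃ (M : Type u) (_ : (towerExtension L).Structure M), IsAmalgam θ P M ∧
      #M = #S + (Order.succ #(predSet S P) + #(predSet S P)) ∧
      #(predSet M (baseRel P : (towerExtension L).Relations 1)) = #(predSet S P) ∧
      #(towerSort L M .indisc) = #(predSet S P) := by
  have : Infinite (predSet S P) := Cardinal.infinite_iff.2 hP
  obtain ⟨Y, U, lt, pr, F, hT, hY, hU⟩ := exists_tower (predSet S P)
  refine ⟨S ⊕ (Y ⊕ U), sumTowerStructure lt pr F, (hT.isAmalgam_sum hS).1, ?_,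
    (hT.isAmalgam_sum hS).2.1, (hT.isAmalgam_sum hS).2.2.trans hU⟩
  rw [← hY, ← hU]
  simp

end Construction

/-! ### Completeness and size of the amalgam sentence. -/

section Sentence

open FirstOrder.Language

variable {L : FirstOrder.Language.{0, 0}}

theorem IsAmalgam.isAbsIndiscernible {θ : InfSentence L} {P : L.Relations 1}
    (hθ : IsCompleteSentence.{u} θ)
    (hP : ∀ (M : Type u) [L.Structure M], Countable M → IsModel M θ → IsAbsIndiscernible M P)
    {M : Type u} [(towerExtension L).Structure M] [Countable M] (h : IsAmalgam θ P M) :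
    IsAbsIndiscernible M (TowerRel.indisc.rel : (towerExtension L).Relations 1) :=
  ⟨Set.infinite_coe_iff.1 h.tower.isTower.infinite_U, fun σ => h.exists_equiv hθ hP h σ⟩

/-- The sentence which axiomatizes the amalgams over a complete sentence is complete. -/
theorem exists_complete_amalgam_sentence [Countable L.Symbols] {θ : InfSentence L} {P : L.Relations 1}
    (hθ : IsCompleteSentence.{u} θ)
    (hP : ∀ (M : Type u) [L.Structure M], Countable M → IsModel M θ → IsAbsIndiscernible M P)
    (hM : ∃ (M : Type u) (_ : L.Structure M), IsModel M θ ∧ ℵ₀ ≤ #(predSet M P)) :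
    ∃ χ : InfSentence (towerExtension L), IsCompleteSentence.{u} χ ∧
      ∀ (M : Type u) [(towerExtension L).Structure M], IsModel M χ ↔ IsAmalgam θ P M := by
  have := countable_towerExtension (L := L)
  obtain ⟨χ, hχ⟩ := exists_amalgam_sentence.{u} θ P
  have hχ' : ∀ (M : Type u) [(towerExtension L).Structure M], IsModel M χ ↔ IsAmalgam θ P M := by
    intro M _
    refine ⟨fun h => (hχ M).1 h.2, fun h => ⟨?_, (hχ M).2 h⟩⟩
    exact h.isModel_base.1.map Subtype.val
  refine ⟨χ, isCompleteSentence_of_countable_equiv χ ?_ ?_, hχ'⟩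
  · obtain ⟨S, _, hS, hinf⟩ := hM
    obtain ⟨M, i, hM, -⟩ := exists_isAmalgam hS hinf
    exact ⟨M, i, (hχ' M).2 hM⟩
  · intro M N _ _ _ _ hM hN
    have hM' := (hχ' M).1 hM
    have hN' := (hχ' N).1 hN
    have := hM'.tower.isTower.infinite_U
    have := hN'.tower.isTower.infinite_U
    -- Any bijection of the countably infinite sorts will do. Prescribing it as a permutation of one
    -- model gives absolute indiscernibility instead.
    obtain ⟨σ⟩ := nonempty_equiv_of_countable (α := towerSort L M .indisc)
      (β := towerSort L N .indisc)
    obtain ⟨e, -⟩ := hM'.exists_equiv hθ hP hN' σ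
    exact ⟨e⟩

theorem IsAmalgam.mk_le {θ : InfSentence L} {P : L.Relations 1} {M : Type u}
    [(towerExtension L).Structure M] (h : IsAmalgam θ P M) {κ : Cardinal.{u}}
    (hbase : #(towerSort L M .base) ≤ Order.succ κ)
    (hP : #(predSet M (baseRel P : (towerExtension L).Relations 1)) ≤ κ) :
    #M ≤ Order.succ κ := by
  have hT := h.tower.isTower
  have hκ : ℵ₀ ≤ Order.succ κ := hT.aleph0_le_mk_X.trans (hP.trans (Order.le_succ κ))
  rw [h.mk_eq]
  refine Cardinal.add_le_of_le hκ hbase (Cardinal.add_le_of_le hκ ?_ ?_)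
  · exact hT.mk_Y_le.trans (Order.succ_le_succ hP)
  · exact hT.mk_U_le.trans (hP.trans (Order.le_succ κ))

theorem add_succ_add_eq {κ : Cardinal.{u}} (hκ : ℵ₀ ≤ κ) :
    κ + (Order.succ κ + κ) = Order.succ κ := by
  have h := hκ.trans (Order.le_succ κ)
  rw [Cardinal.add_eq_left h (Order.le_succ κ), Cardinal.add_eq_right h (Order.le_succ κ)]

end Sentence

/-! ### The infinite pure set, which is the base for (A). -/

section PureSet

open FirstOrder.Language

/-- The vocabulary with a single unary predicate. -/
abbrev unaryLanguage : FirstOrder.Language.{0, 0} :=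
  ⟨fun _ => Empty, fun n => {_u : Unit // n = 1}⟩

def unaryPred : unaryLanguage.Relations 1 := ⟨(), rfl⟩

theorem countable_unaryLanguage : Countable unaryLanguage.Symbols :=
  inferInstanceAs (Countable ((Σ _ : ℕ, Empty) ⊕ (Σ n : ℕ, {_u : Unit // n = 1})))

open InfDefinable in
theorem exists_infinite_sentence : ∃ θ : InfSentence unaryLanguage,
    ∀ (M : Type u) [unaryLanguage.Structure M],
      IsModel M θ ↔ Infinite M ∧ ∀ a, a ∈ predSet M unaryPred := by
  have h : InfDefinable.{u} unaryLanguage (n := 0) fun M _ _ =>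
      (∀ (m : ℕ) (v : Fin m → M), ∃ a, ∀ i, ¬ v i = a) ∧ ∀ a, a ∈ predSet M unaryPred := by
    repeat' first
      | exact mem_predSet _ _
      | exact InfDefinable.eq _ _
      | apply InfDefinable.and
      | apply InfDefinable.not
      | apply InfDefinable.all
      | apply InfDefinable.ex
      | apply InfDefinable.allTuple
      | (refine InfDefinable.forall_countable fun _ => ?_)
  obtain ⟨θ, hθ⟩ := h
  refine ⟨θ, fun M _ => ?_⟩
  constructor
  · intro h
    obtain ⟨h1, h2⟩ := (hθ M _).1 h.2
    refine ⟨not_finite_iff_infinite.1 fun hfin => ?_, h2⟩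
    obtain ⟨n, ⟨e⟩⟩ := Finite.exists_equiv_fin M
    obtain ⟨a, ha⟩ := h1 n e.symm
    exact ha (e a) (e.symm_apply_apply a)
  · rintro ⟨h1, h2⟩
    refine ⟨inferInstance, (hθ M _).2 ⟨fun m v => ?_, h2⟩⟩
    classical
    obtain ⟨a, ha⟩ := Infinite.exists_notMem_finset (Finset.univ.image v)
    exact ⟨a, fun i hi => ha (Finset.mem_image.2 ⟨i, Finset.mem_univ _, hi⟩)⟩

/-- Bijections between structures in which the unary predicate holds everywhere. -/
def unaryEquiv {M N : Type u} [unaryLanguage.Structure M] [unaryLanguage.Structure N]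
    (hM : ∀ a, a ∈ predSet M unaryPred) (hN : ∀ a, a ∈ predSet N unaryPred) (e : M ≃ N) :
    M ≃[unaryLanguage] N where
  toEquiv := e
  map_fun' f := f.elim
  map_rel' := by
    rintro n ⟨-, rfl⟩ v
    have h1 : v = ![v 0] := funext fun i => by fin_cases i; rfl
    have h2 : e.toFun ∘ v = ![e (v 0)] := funext fun i => by fin_cases i; rfl
    rw [h2, h1]
    exact iff_of_true (hN _) (hM _)

/-- With the predicate true everywhere, every bijection is an isomorphism. This gives absolute
indiscernibility, uniqueness of the countable model and models in every infinite size. -/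
theorem exists_pure_sentence : ∃ θ : InfSentence unaryLanguage, IsCompleteSentence.{u} θ ∧
    (∀ (M : Type u) [unaryLanguage.Structure M], Countable M → IsModel M θ →
      IsAbsIndiscernible M unaryPred) ∧
    (∀ (M : Type u) [unaryLanguage.Structure M], IsModel M θ → predSet M unaryPred = Set.univ) ∧
    ∀ κ : Cardinal.{u}, ℵ₀ ≤ κ → ∃ (M : Type u) (_ : unaryLanguage.Structure M),
      IsModel M θ ∧ #M = κ ∧ #(predSet M unaryPred) = κ := by
  have := countable_unaryLanguage
  obtain ⟨θ, hθ⟩ := exists_infinite_sentence.{u}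
  have hmod : ∀ κ : Cardinal.{u}, ℵ₀ ≤ κ → ∃ (M : Type u) (_ : unaryLanguage.Structure M),
      IsModel M θ ∧ #M = κ ∧ #(predSet M unaryPred) = κ := by
    intro κ hκ
    let i : unaryLanguage.Structure κ.out := ⟨fun f => f.elim, fun _ _ => True⟩
    have h : predSet κ.out unaryPred = Set.univ := Set.eq_univ_of_forall fun _ => trivial
    refine ⟨κ.out, i, (hθ _).2 ⟨?_, fun _ => trivial⟩, Cardinal.mk_out κ, ?_⟩
    · rw [Cardinal.infinite_iff, Cardinal.mk_out]
      exact hκ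
    · rw [h, Cardinal.mk_univ, Cardinal.mk_out]
  refine ⟨θ, isCompleteSentence_of_countable_equiv θ ?_ ?_, ?_, ?_, hmod⟩
  · obtain ⟨M, i, h, -⟩ := hmod ℵ₀ le_rfl
    exact ⟨M, i, h⟩
  · intro M N _ _ _ _ hM hN
    obtain ⟨h1, h2⟩ := (hθ M).1 hM
    obtain ⟨h3, h4⟩ := (hθ N).1 hN
    obtain ⟨e⟩ := nonempty_equiv_of_countable (α := M) (β := N)
    exact ⟨unaryEquiv h2 h4 e⟩
  · intro M _ _ hM
    obtain ⟨h1, h2⟩ := (hθ M).1 hM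
    have h3 : predSet M unaryPred = Set.univ := Set.eq_univ_of_forall h2
    refine ⟨h3 ▸ Set.infinite_univ, fun σ => ?_⟩
    let e : predSet M unaryPred ≃ M := Equiv.subtypeUnivEquiv h2
    refine ⟨unaryEquiv h2 h2 (e.symm.trans (σ.trans e)), fun a => ?_⟩
    change ((σ (e.symm a)) : M) = σ a
    rfl
  · intro M _ hM
    exact Set.eq_univ_of_forall ((hθ M).1 hM).2

end PureSet

/-! ### Assembly of (A) and (B). -/

theorem mainTheorem8 :
    (∃ (L : FirstOrder.Language.{0, 0}) (_ : Countable L.Symbols)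
        (X Y U : L.Relations 1) (lt : L.Relations 2) (φ : InfSentence L),
      IsCompleteSentence.{u} φ ∧
      (∀ (M : Type u) [L.Structure M], IsModel M φ → HasOrderedSort M X Y U lt) ∧
      (∀ κ : Cardinal.{u}, ∃ (M : Type u) (_ : L.Structure M), IsModel M φ ∧ κ ≤ #M) ∧
      (∀ (M : Type u) [L.Structure M], IsModel M φ → #M ≤ Order.succ #(predSet M X)) ∧
      (∀ κ : Cardinal.{u}, ℵ₀ ≤ κ → ∃ (M : Type u) (_ : L.Structure M),
        IsModel M φ ∧ #M = Order.succ κ ∧ #(predSet M X) = κ) ∧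
      (∀ (M : Type u) [L.Structure M], Countable M → IsModel M φ → IsAbsIndiscernible M U) ∧
      (∀ (M : Type u) [L.Structure M], IsModel M φ → #(predSet M U) ≤ #(predSet M X)) ∧
      (∀ κ : Cardinal.{u}, ℵ₀ ≤ κ → ∃ (N : Type u) (_ : L.Structure N),
        IsModel N φ ∧ #N = Order.succ κ ∧ #(predSet N U) = κ)) ∧
    (∀ (L : FirstOrder.Language.{0, 0}) [Countable L.Symbols] (θ : InfSentence L)
        (P : L.Relations 1) (κ : Cardinal.{u}), HomogeneouslyCharacterizes θ P κ →
      ∃ (L' : FirstOrder.Language.{0, 0}) (_ : Countable L'.Symbols) (ι : L →ᴸ L')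
        (U : L'.Relations 1) (χ : InfSentence L'),
        ι.Injective ∧
        IsCompleteSentence.{u} χ ∧
        Characterizes χ (Order.succ κ) ∧
        (∀ (M : Type u) [L'.Structure M], Countable M → IsModel M χ → IsAbsIndiscernible M U) ∧
        (∀ (M : Type u) [L'.Structure M], IsModel M χ → #(predSet M U) ≤ κ) ∧
        (∃ (M : Type u) (_ : L'.Structure M), IsModel M χ ∧ #(predSet M U) = κ)) := by

  constructor
  · have := countable_unaryLanguage
    obtain ⟨θ, hθ, hP, huniv, hmod⟩ := exists_pure_sentence.{u}
    obtain ⟨χ, hχ, hχ'⟩ := exists_complete_amalgam_sentence hθ hP (by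
      obtain ⟨M, i, h1, -, h2⟩ := hmod ℵ₀ le_rfl
      exact ⟨M, i, h1, h2.ge⟩)
    have hex : ∀ κ : Cardinal.{u}, ℵ₀ ≤ κ →
        ∃ (M : Type u) (_ : (towerExtension unaryLanguage).Structure M), IsModel M χ ∧
          #M = Order.succ κ ∧ #(predSet M (baseRel unaryPred)) = κ ∧
          #(towerSort unaryLanguage M .indisc) = κ := by
      intro κ hκ
      obtain ⟨S, _, h1, h2, h3⟩ := hmod κ hκ
      obtain ⟨M, i, h4, h5, h6, h7⟩ := exists_isAmalgam h1 (h3.ge.trans' hκ)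
      refine ⟨M, i, (hχ' M).2 h4, ?_, h6.trans h3, h7.trans h3⟩
      rw [h5, h2, h3, add_succ_add_eq hκ]
    refine ⟨towerExtension unaryLanguage, countable_towerExtension, baseRel unaryPred,
      TowerRel.ordered.rel, TowerRel.indisc.rel, TowerRel.lt.rel, χ, hχ, ?_, ?_, ?_, ?_, ?_, ?_, ?_⟩
    · exact fun M _ hM => ((hχ' M).1 hM).hasOrderedSort
    · intro κ
      obtain ⟨M, i, h1, h2, -⟩ := hex (max ℵ₀ κ) (le_max_left _ _)
      exact ⟨M, i, h1, h2 ▸ (le_max_right _ _).trans (Order.le_succ _)⟩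
    · intro M _ hM
      have h := (hχ' M).1 hM
      refine h.mk_le ?_ le_rfl
      refine le_trans ?_ (Order.le_succ _)
      let _ := h.baseStructure
      -- Over the pure set the whole base sort lies in X, so |X| bounds the base as well.
      refine Cardinal.mk_le_mk_of_subset fun a ha => ?_
      have : (⟨a, ha⟩ : towerSort unaryLanguage M .base) ∈
          predSet (towerSort unaryLanguage M .base) unaryPred := by
        rw [huniv _ h.isModel_base]
        trivial
      exact (h.mem_predSet_base ⟨a, ha⟩).1 this
    · intro κ hκ
      obtain ⟨M, i, h1, h2, h3, -⟩ := hex κ hκ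
      exact ⟨M, i, h1, h2, h3⟩
    · intro M _ _ hM
      exact ((hχ' M).1 hM).isAbsIndiscernible hθ hP
    · intro M _ hM
      exact ((hχ' M).1 hM).tower.isTower.mk_U_le
    · intro κ hκ
      obtain ⟨M, i, h1, h2, -, h3⟩ := hex κ hκ
      exact ⟨M, i, h1, h2, h3⟩
  · intro L _ θ P κ hκ
    obtain ⟨S, _, hS, hSκ, hPκ⟩ := hκ.maximal_model
    obtain ⟨χ, hχ, hχ'⟩ := exists_complete_amalgam_sentence hκ.complete hκ.indiscernible
      ⟨S, _, hS.1, hPκ.ge.trans' hκ.infinite⟩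
    obtain ⟨M, i, h4, h5, h6, h7⟩ := exists_isAmalgam hS.1 (hPκ.ge.trans' hκ.infinite)
    -- The base of any amalgam is itself a model of `θ`, so the bound for `θ` limits X and, through
    -- the tower, the whole structure.
    have hbase : ∀ (N : Type u) [(towerExtension L).Structure N] (h : IsAmalgam θ P N),
        #(towerSort L N .base) ≤ κ := by
      intro N _ h
      let _ := h.baseStructure
      exact mk_le_of_forall_model_ne_succ θ κ hκ.infinite hκ.no_model_succ _ h.isModel_base
    have hpred : ∀ (N : Type u) [(towerExtension L).Structure N] (h : IsAmalgam θ P N),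
        #(predSet N (baseRel P : (towerExtension L).Relations 1)) ≤ κ := fun N _ h =>
      (Cardinal.mk_le_mk_of_subset h.predSet_subset).trans (hbase N h)
    refine ⟨towerExtension L, countable_towerExtension, FirstOrder.Language.LHom.sumInl,
      TowerRel.indisc.rel, χ, FirstOrder.Language.LHom.sumInl_injective, hχ, ⟨?_, ?_⟩, ?_, ?_, ?_⟩
    · refine ⟨M, i, (hχ' M).2 h4, ?_⟩
      rw [h5, hSκ, hPκ, add_succ_add_eq hκ.infinite]
    · intro N _ hN
      have h := (hχ' N).1 hN
      exact h.mk_le ((hbase N h).trans (Order.le_succ κ)) (hpred N h)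
    · intro N _ _ hN
      exact ((hχ' N).1 hN).isAbsIndiscernible hκ.complete hκ.indiscernible
    · intro N _ hN
      have h := (hχ' N).1 hN
      exact h.tower.isTower.mk_U_le.trans (hpred N h)
    · exact ⟨M, i, (hχ' M).2 h4, h7.trans hPκ⟩
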